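/- **Theorem 3.1.** Let $d\ge 1$, $n_1,\dots,n_d\ge 1$, $[\boldsymbol n]=[n_1]\times\cdots\times[n_d]$. Let $\boldsymbol f^{(X_p)}\in\mathbb R_+^{[n_p]}$ ($p=1,\dots,d$) be degree sequences, i.e. non-increasing vectors with non-negative real entries, and let $B\in[0,\infty]$. A tensor $\boldsymbol M\in\mathbb R^{[\boldsymbol n]}$ is *consistent* with $\boldsymbol f^{(\boldsymbol X)},B$ if $\sum_{\boldsymbol x:\,x_p=i}M_{\boldsymbol x}\le f^{(X_p)}_i$ for all $p$ and $i\in[n_p]$, and $M_{\boldsymbol x}\le B$ for all $\boldsymbol x$. Let $\mathcal M_{\boldsymbol f,B}$ be the set of consistent tensors and $\mathcal M^+_{\boldsymbol f,B}$ the set of the non-negative ones. Write $(\boldsymbol M\circ\boldsymbol\sigma)_{\boldsymbol x}=M_{\sigma_1(x_1),\dots,\sigma_d(x_d)}$ for permutations $\sigma_p$ of $[n_p]$, and $\boldsymbol M\cdot\boldsymbol a^{(1)}\cdots\boldsymbol a^{(d)}=\sum_{\boldsymbol x}M_{\boldsymbol x}\prod_p a^{(p)}_{x_p}$. Put $$V_{\boldsymbol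 m}=\max\Big\{\sum_{\boldsymbol s\le\boldsymbol m}M_{\boldsymbol s}\;:\;\boldsymbol M\in\mathcal M^+_{\boldsymbol f,B}\Big\}\quad(\boldsymbol m\in[\boldsymbol n]),\qquad \boldsymbol C=\Delta_{X_1}\cdots\Delta_{X_d}\boldsymbol V,$$ where $\Delta_{X_p}$ is the discrete derivative $T_{\boldsymbol x}-T_{\boldsymbol x-\boldsymbol e_p}$ along dimension $p$ (the second term being $0$ if $x_p=1$). The maximum defining $V_{\boldsymbol m}$ is attained. A *solution* (of the worst-case tensor problem for $\boldsymbol f,B$) is a tensor $\boldsymbol C'\in\mathcal M_{\boldsymbol f,\infty}$ such that $$(\boldsymbol M\circ\boldsymbol\sigma)\cdot\boldsymbol a^{(1)}\cdots\boldsymbol a^{(d)}\;\le\;\boldsymbol C'\cdot\boldsymbol a^{(1)}\cdots\boldsymbol a^{(d)}\qquad(*)$$ for all $\boldsymbol M\in\mathcal M^+_{\boldsymbol f,B}$, all tuples of permutations $\boldsymbol\sigma$, and all non-increasing $\boldsymbol a^{(p)}\in\mathbb R_+^{[n_p]}$. Then: 1. $\boldsymbol C$ is a solution. It is tight: for every $\boldsymbol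 m\in[\boldsymbol n]$ there is $\boldsymbol M\in\mathcal M^+_{\boldsymbol f,B}$ such that $(*)$ for $\boldsymbol C'=\boldsymbol C$, with $\boldsymbol\sigma$ the identity, is an equality for the non-increasing vectors $\boldsymbol a^{(p)}=(1,\dots,1,0,\dots,0)$ with exactly $m_p$ ones. 2. If some $\boldsymbol C'\in\mathcal M^+_{\boldsymbol f,B}$ is a solution, then $\boldsymbol C'=\boldsymbol C$. 3. If $d=2$, then $\boldsymbol C\ge 0$, and if moreover all $f^{(X_p)}_i$ are integers and $B$ is an integer or $\infty$, then $\boldsymbol C$ has integer entries. For every $d\ge3$ and every finite $B>0$ there are $n_p\ge1$ and degree sequences for which $\boldsymbol C$ has a negative entry. 4. For every $d\ge 2$ (in particular $d=2$) and every finite $B>0$ there are $n_p\ge1$ and degree sequences for which $\boldsymbol C$ has an entry $>B$. 5. For every dimension $q$ and all non-increasing $\boldsymbol a^{(p)}\in\mathbb R_+^{[n_p]}$, $p\neq q$, the vector $\big(\sum_{\boldsymbol x:\,x_q=i}C_{\boldsymbol x}\prod_{p\ne q}a^{(p)}_{x_p}\big)_{i\in[n_q]}$ (for $q=1$: $\boldsymbol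 C\cdot\boldsymbol a^{(2)}\cdots\boldsymbol a^{(d)}$) is non-negative and non-increasing. 6. If $B=\infty$, then $V_{\boldsymbol m}=\min_p F^{(X_p)}_{m_p}$ for all $\boldsymbol m$, where $F^{(X_p)}_r=\sum_{j\le r}f^{(X_p)}_j$, and $\boldsymbol C\ge0$, i.e. $\boldsymbol C\in\mathcal M^+_{\boldsymbol f,\infty}$. Moreover, $\boldsymbol C$ is computed by the following greedy algorithm, however ties in the choice of $p_{\min}$ are broken: start with $s_p=1$ for all $p$ and $\boldsymbol C=0$; while $s_p\le n_p$ for all $p$, let $d_{\min}=\min_p f^{(X_p)}_{s_p}$, attained at $p_{\min}$, set $C_{s_1,\dots,s_d}\leftarrow d_{\min}$, subtract $d_{\min}$ from every $f^{(X_p)}_{s_p}$, and increment $s_{p_{\min}}$. The algorithm makes at most $\sum_p n_p$ passes through its loop. With unit-cost operations on real numbers, and with $\boldsymbol C$ output as a list of entries (those not listed being $0$), it takes at most $c\,d\sum_p n_p$ steps, where $c$ is a universal constant; that is, time $O(\sum_p n_p)$ for each fixed $d$. -/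

import Mathlib

open scoped NNReal ENNReal

noncomputable section

namespace StarQuery

/-- Index tuples `[n₁] × ⋯ × [n_d]`; the ranks `1, …, n_p` of the text are `0, …, n_p - 1` here. -/
abbrev Idx {d : ℕ} (n : Fin d → ℕ) : Type := (p : Fin d) → Fin (n p)

/-- Real `d`-dimensional tensors of shape `n₁ × ⋯ × n_d`. -/
abbrev Tensor {d : ℕ} (n : Fin d → ℕ) : Type := Idx n → ℝ

/-- A tuple of vectors, the `p`-th one in `ℝ^[n_p]`. -/
abbrev Vectors {d : ℕ} (n : Fin d → ℕ) : Type := (p : Fin d) → Fin (n p) → ℝ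

/-- Non-increasing vectors with non-negative entries. Degree sequences are exactly these. -/
def IsNonincreasing {k : ℕ} (a : Fin k → ℝ) : Prop :=
  (∀ i, 0 ≤ a i) ∧ Antitone a

section
variable {d : ℕ} {n : Fin d → ℕ}

/-- The marginal of `M` along dimension `p`: sum out all the other dimensions. -/
def marginal (M : Tensor n) (p : Fin d) (i : Fin (n p)) : ℝ :=
  ∑ x : Idx n, if x p = i then M x else 0

/-- The tensors (of arbitrary sign) consistent with the degree sequences `f` and with the
max tuple multiplicity `B`, where `B = ∞` is allowed. -/
def consistent (f : Vectors n) (B : ℝ≥0∞) : Set (Tensor n) :=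
  {M | (∀ p i, marginal M p i ≤ f p i) ∧ ∀ x, (M x : EReal) ≤ (B : EReal)}

/-- The non-negative consistent tensors. -/
def consistentNonneg (f : Vectors n) (B : ℝ≥0∞) : Set (Tensor n) :=
  {M | (∀ x, 0 ≤ M x) ∧ M ∈ consistent f B}

/-- The permuted tensor `M ∘ σ`. -/
def permute (M : Tensor n) (σ : (p : Fin d) → Equiv.Perm (Fin (n p))) : Tensor n :=
  fun x => M (fun p => σ p (x p))

/-- The full product `M · a⁽¹⁾ ⋯ a⁽ᵈ⁾`. -/
def dot (M : Tensor n) (a : Vectors n) : ℝ :=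
  ∑ x : Idx n, M x * ∏ p, a p (x p)

/-- The product of `M` with all the vectors `a⁽ᵖ⁾`, `p ≠ q`, which is a vector
indexed by dimension `q` (the component `a⁽q⁾` is not used). -/
def dotExcept (q : Fin d) (M : Tensor n) (a : Vectors n) (i : Fin (n q)) : ℝ :=
  ∑ x : Idx n, if x q = i then M x * ∏ p ∈ Finset.univ.erase q, a p (x p) else 0

/-- `C` solves the worst-case tensor problem for `f, B`. -/
def IsWorstCaseSolution (f : Vectors n) (B : ℝ≥0∞) (C : Tensor n) : Prop :=
  C ∈ consistent f ∞ ∧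
    ∀ σ : (p : Fin d) → Equiv.Perm (Fin (n p)), ∀ M ∈ consistentNonneg f B,
      ∀ a : Vectors n, (∀ p, IsNonincreasing (a p)) → dot (permute M σ) a ≤ dot C a

/-- The values of the objective `∑_{s ≤ m} M_s` over the non-negative consistent tensors. -/
def boxSums (f : Vectors n) (B : ℝ≥0∞) (m : Idx n) : Set ℝ :=
  (fun M : Tensor n => ∑ s ∈ Finset.Iic m, M s) '' consistentNonneg f B

/-- The value tensor `V`. -/
def valueTensor (f : Vectors n) (B : ℝ≥0∞) : Tensor n :=
  fun m => sSup (boxSums f B m)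

/-- The discrete derivative along dimension `p`: `T_x - T_{x - e_p}`, where the second
term is `0` if `x_p` is the first rank. -/
def delta (p : Fin d) (T : Tensor n) : Tensor n := fun x =>
  T x - if (x p).val = 0 then 0
    else T (Function.update x p ⟨(x p).val - 1, (Nat.sub_le _ _).trans_lt (x p).isLt⟩)

/-- The worst-case tensor `C = Δ_{X₁} ⋯ Δ_{X_d} V`. -/
def worstCaseTensor (f : Vectors n) (B : ℝ≥0∞) : Tensor n :=
  (List.finRange d).foldr delta (valueTensor f B)

/-- The vectors `(1, …, 1, 0, …, 0)`, with ones exactly at the ranks up to `m_p`. -/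
def oneZero (m : Idx n) : Vectors n := fun p i => if i ≤ m p then 1 else 0

/-- The cumulative degree sequences `F_r = ∑_{j ≤ r} f_j`. -/
def cumulative (f : Vectors n) (p : Fin d) (r : Fin (n p)) : ℝ :=
  ∑ j ∈ Finset.Iic r, f p j

end

/-! The greedy algorithm, as a random access machine with real entries. One transition
performs a bounded number of elementary operations (read or write one memory cell, compare,
subtract, add one to a counter); everything that concerns all `d` dimensions is a loop with
one transition per dimension. The running time is the number of transitions. -/

/-- Control locations; the argument is the counter of the loop over the dimensions. -/
inductive Loc : Type
  | init (p : ℕ)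
  | test (p : ℕ)
  | scan (p : ℕ)
  | addr (p : ℕ)
  | write
  | sub (p : ℕ)
  | incr
  | halt

/-- Memory of the machine: the current position `s`, the residual degrees `r`, the minimum
found so far and its dimension, and the output, a list of `len` entries in coordinate format:
entry number `k` has the index tuple `idx k` and the value `val k`. -/
structure State (d : ℕ) : Type where
  loc : Loc
  s : Fin d → ℕ
  r : Fin d → ℕ → ℝ
  pmin : ℕ
  dmin : ℝ
  idx : ℕ → Fin d → ℕ
  val : ℕ → ℝ
  len : ℕ

/-- The initial state: the arrays `r` hold the degree sequences, the output is empty. -/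
def start {d : ℕ} {n : Fin d → ℕ} (f : Vectors n) : State d where
  loc := Loc.init 0
  s := fun _ => 0
  r := fun p i => if h : i < n p then f p ⟨i, h⟩ else 0
  pmin := 0
  dmin := 0
  idx := fun _ _ => 0
  val := fun _ => 0
  len := 0

/-- One transition of the machine.
* `init`: set every `s_p` to the first rank;
* `test`: go on while every `s_p` is within its range, otherwise halt;
* `scan`: compute `d_min = min_p r⁽ᵖ⁾_{s_p}` and some dimension `p_min` at which this minimum
  is reached (`τ` decides, arbitrarily, whether `p_min` is replaced in case of a tie);
* `addr`, `write`: output the assignment `C_{s_1, …, s_d} ← d_min`;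
* `sub`: subtract `d_min` from every `r⁽ᵖ⁾_{s_p}`;
* `incr`: increment `s_{p_min}` and return to the test. -/
def step {d : ℕ} (n : Fin d → ℕ) (τ : State d → Bool) (S : State d) : State d :=
  match S.loc with
  | Loc.init p =>
      if h : p < d then
        { S with s := Function.update S.s ⟨p, h⟩ 0, loc := Loc.init (p + 1) }
      else { S with loc := Loc.test 0 }
  | Loc.test p =>
      if h : p < d then
        if S.s ⟨p, h⟩ < n ⟨p, h⟩ then { S with loc := Loc.test (p + 1) }
        else { S with loc := Loc.halt }
      else { S with loc := Loc.scan 0 }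
  | Loc.scan p =>
      if h : p < d then
        if p = 0 ∨ S.r ⟨p, h⟩ (S.s ⟨p, h⟩) < S.dmin ∨
            (S.r ⟨p, h⟩ (S.s ⟨p, h⟩) = S.dmin ∧ τ S = true) then
          { S with pmin := p, dmin := S.r ⟨p, h⟩ (S.s ⟨p, h⟩), loc := Loc.scan (p + 1) }
        else { S with loc := Loc.scan (p + 1) }
      else { S with loc := Loc.addr 0 }
  | Loc.addr p =>
      if h : p < d then
        { S with
          idx := Function.update S.idx S.len
            (Function.update (S.idx S.len) ⟨p, h⟩ (S.s ⟨p, h⟩))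
          loc := Loc.addr (p + 1) }
      else { S with loc := Loc.write }
  | Loc.write =>
      { S with val := Function.update S.val S.len S.dmin, len := S.len + 1, loc := Loc.sub 0 }
  | Loc.sub p =>
      if h : p < d then
        { S with
          r := Function.update S.r ⟨p, h⟩
            (Function.update (S.r ⟨p, h⟩) (S.s ⟨p, h⟩)
              (S.r ⟨p, h⟩ (S.s ⟨p, h⟩) - S.dmin))
          loc := Loc.sub (p + 1) }
      else { S with loc := Loc.incr }
  | Loc.incr =>
      { S with s := fun p => if p.val = S.pmin then S.s p + 1 else S.s p, loc := Loc.test 0 }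
  | Loc.halt => S

/-- The tensor given by the output list: the entries not listed are `0`. -/
def State.output {d : ℕ} (n : Fin d → ℕ) (S : State d) : Tensor n := fun x =>
  ∑ k ∈ Finset.range S.len, if ∀ p, S.idx k p = (x p).val then S.val k else 0

end StarQuery

end

open StarQuery

/-!
Everything goes through box sums. Summation by parts (`dot_mixedDelta`) says that the mixed
derivative is inverse to the box sums, so `C` is the only tensor with box sums `V`, and that a full
product with non-increasing vectors is a combination, with non-negative coefficients, of box sums.

* *Solution and uniqueness.* By the above, `(*)` for all non-increasing vectors only has to be
  checked for box sums. The entries of a permuted tensor in the box below `m` can be moved back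
  to ranks that are no larger, where the degree bounds are no smaller, so their sum is at most
  `V_m` (`boxSum_permute_le`). A consistent solution has box sums between `V` and `V`.
* *Slices.* A slice of `C` against non-increasing vectors is a non-negative combination of first
  differences of `V` along one dimension (`dotExcept_mixedDelta`), and `V` is monotone with
  increments bounded by the degrees, and concave in each dimension. For concavity, average optimal
  tensors for the ranks `r` and `r - 2` and merge the slice `r` into the slice `r - 1`
  (`foldSlice_mem`).
* *Two dimensions.* `V_m` is the value of a maximum flow in a bipartite network, hence of a
  minimum cut (`exists_cut_eq`). Cuts are integral for integral data, and uncrossing two of them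
  (`cut_uncross`) shows that `V` has increasing differences, which is `C ≥ 0`. An infinite `B` can
  be replaced by a large integer.
* *Examples.* Constant tensors on boxes give lower bounds for `V`, and degrees and `B` give upper
  bounds. For degree sequences that are constant in each dimension they pin down the four values
  of `V` that make up an entry of `C` in two proper dimensions.
* *The greedy algorithm.* Its loop invariant (`Invariant`) determines the box sums of the output at
  every time as the minimum of the total output so far and of the cumulative degrees. At the end
  they are the minimal cumulative degrees, which bound `V` from above. So the output is consistent
  and has box sums `V` for `B = ∞`, and hence is `C`.
-/

noncomputable section

namespace StarQuery

/-! ### Summation by parts -/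

section
variable {d : ℕ} {n : Fin d → ℕ}

/-- The forward difference `a_i - a_{i+1}` of a vector, where the entry after the last one counts
as `0`. It is the transpose of the discrete derivative. -/
def drop {k : ℕ} (a : Fin k → ℝ) (i : Fin k) : ℝ :=
  a i - if h : i.val + 1 < k then a ⟨i.val + 1, h⟩ else 0

lemma drop_nonneg {k : ℕ} {a : Fin k → ℝ} (ha : IsNonincreasing a) (i : Fin k) :
    0 ≤ drop a i := by
  unfold drop
  split_ifs with h
  · exact sub_nonneg.2 (ha.2 (Fin.le_def.2 (Nat.le_succ _)))
  · simpa using ha.1 i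

lemma drop_single_succ {k : ℕ} (i j : Fin k) (h : i.val + 1 = j.val) :
    drop (Pi.single j (1 : ℝ)) = Pi.single j 1 - Pi.single i 1 := by
  ext l
  have hj := j.isLt
  by_cases h1 : l = i
  · subst h1
    have h2 : (⟨l.val + 1, by omega⟩ : Fin k) = j := Fin.ext h
    have h3 : l.val + 1 < k := by omega
    simp [drop, h2, h3]
  · by_cases h3 : l.val + 1 < k
    · have h2 : (⟨l.val + 1, h3⟩ : Fin k) ≠ j := fun e => h1 (Fin.ext (by
        have := congrArg Fin.val e; simp at this; omega))
      simp [drop, h3, Pi.single_eq_of_ne h2, Pi.single_eq_of_ne h1]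
    · simp [drop, h3, Pi.single_eq_of_ne h1]

lemma drop_le_indicator {k : ℕ} (m : Fin k) :
    drop (fun i => if i ≤ m then (1 : ℝ) else 0) = Pi.single m 1 := by
  ext l
  unfold drop
  rw [Pi.single_apply]
  have := m.isLt
  simp only [Fin.le_def, Fin.ext_iff]
  split_ifs <;> first | omega | norm_num

/-- Full products split off the factor of one dimension. -/
lemma dot_update (p : Fin d) (T : Tensor n) (a : Vectors n) (b : Fin (n p) → ℝ) :
    dot T (Function.update a p b) =
      ∑ x : Idx n, T x * (b (x p) * ∏ q ∈ Finset.univ.erase p, a q (x q)) := by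
  unfold dot
  refine Finset.sum_congr rfl fun x _ => ?_
  rw [← Finset.mul_prod_erase _ _ (Finset.mem_univ p), Function.update_self]
  congr 2
  exact Finset.prod_congr rfl fun q hq => by
    rw [Function.update_of_ne (Finset.ne_of_mem_erase hq)]

lemma prod_erase_update (p : Fin d) (a : Vectors n) (x : Idx n) (j : Fin (n p)) :
    ∏ q ∈ Finset.univ.erase p, a q (Function.update x p j q) =
      ∏ q ∈ Finset.univ.erase p, a q (x q) :=
  Finset.prod_congr rfl fun q hq => by rw [Function.update_of_ne (Finset.ne_of_mem_erase hq)]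

/-- Summation by parts in one dimension: the discrete derivative of the tensor can be moved to the
vector of that dimension. -/
lemma dot_delta (p : Fin d) (T : Tensor n) (a : Vectors n) :
    dot (delta p T) a = dot T (Function.update a p (drop (a p))) := by
  have h0 : dot (delta p T) a = ∑ x : Idx n, delta p T x *
      (a p (x p) * ∏ q ∈ Finset.univ.erase p, a q (x q)) := by
    conv_lhs => rw [← Function.update_eq_self p a]
    exact dot_update p _ a _
  rw [h0, dot_update]
  simp only [delta, drop, sub_mul, mul_sub, Finset.sum_sub_distrib]
  congr 1
  have e1 : ∀ x : Idx n, (if (x p).val = 0 then 0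
      else T (Function.update x p ⟨(x p).val - 1, (Nat.sub_le _ _).trans_lt (x p).isLt⟩)) *
        (a p (x p) * ∏ q ∈ Finset.univ.erase p, a q (x q)) =
      if (x p).val ≠ 0 then
        T (Function.update x p ⟨(x p).val - 1, (Nat.sub_le _ _).trans_lt (x p).isLt⟩) *
        (a p (x p) * ∏ q ∈ Finset.univ.erase p, a q (x q)) else 0 := fun x => by
    by_cases h : (x p).val = 0 <;> simp [h]
  have e2 : ∀ x : Idx n, T x * ((if h : (x p).val + 1 < n p then a p ⟨(x p).val + 1, h⟩ else 0) *
        ∏ q ∈ Finset.univ.erase p, a q (x q)) =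
      if (x p).val + 1 < n p then T x * ((if h : (x p).val + 1 < n p then
        a p ⟨(x p).val + 1, h⟩ else 0) * ∏ q ∈ Finset.univ.erase p, a q (x q)) else 0 :=
    fun x => by by_cases h : (x p).val + 1 < n p <;> simp [h]
  rw [Finset.sum_congr rfl fun x _ => e1 x, Finset.sum_congr rfl fun x _ => e2 x,
    ← Finset.sum_filter, ← Finset.sum_filter]
  refine Finset.sum_bij'
    (fun x _ => Function.update x p ⟨(x p).val - 1, (Nat.sub_le _ _).trans_lt (x p).isLt⟩)
    (fun x hx => Function.update x p ⟨(x p).val + 1, (Finset.mem_filter.1 hx).2⟩)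
    ?_ ?_ ?_ ?_ ?_
  · intro x hx
    have := (Finset.mem_filter.1 hx).2
    have := (x p).isLt
    simp
    omega
  · intro x hx
    simp
  · intro x hx
    have h := (Finset.mem_filter.1 hx).2
    have : (x p).val - 1 + 1 = (x p).val := by omega
    simp [this]
  · intro x hx
    simp
  · intro x hx
    have h := (Finset.mem_filter.1 hx).2
    have h2 : (x p).val - 1 + 1 = (x p).val := by omega
    rw [prod_erase_update]
    simp [h2]

/-- The mixed discrete derivative along all the dimensions. -/
abbrev mixedDelta (T : Tensor n) : Tensor n := (List.finRange d).foldr delta T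

lemma dot_foldr_delta (l : List (Fin d)) (hl : l.Nodup) (T : Tensor n) (a : Vectors n) :
    dot (l.foldr delta T) a = dot T (fun p => if p ∈ l then drop (a p) else a p) := by
  induction l generalizing a with
  | nil => simp
  | cons p l ih =>
    rw [List.foldr_cons, dot_delta, ih (List.nodup_cons.1 hl).2]
    congr 1
    ext q : 1
    have hp := (List.nodup_cons.1 hl).1
    by_cases hq : q = p
    · subst hq; simp [hp]
    · simp [hq]

lemma dot_mixedDelta (T : Tensor n) (a : Vectors n) :
    dot (mixedDelta T) a = dot T (fun p => drop (a p)) := by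
  simp [mixedDelta, dot_foldr_delta _ (List.nodup_finRange d)]

lemma dot_single (T : Tensor n) (m : Idx n) :
    dot T (fun p => Pi.single (m p) 1) = T m := by
  unfold dot
  rw [Finset.sum_eq_single m]
  · simp
  · intro x _ hx
    obtain ⟨p, hp⟩ := Function.ne_iff.1 hx
    rw [Finset.prod_eq_zero (Finset.mem_univ p) (Pi.single_eq_of_ne hp _), mul_zero]
  · simp

/-- The sums of a tensor over the boxes below the index tuples. -/
def boxSum (T : Tensor n) : Tensor n := fun m => ∑ s ∈ Finset.Iic m, T s

lemma boxSum_eq_sum_ite (T : Tensor n) (m : Idx n) :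
    boxSum T m = ∑ x : Idx n, if ∀ p, x p ≤ m p then T x else 0 := by
  have : Finset.Iic m = Finset.univ.filter (fun x : Idx n => ∀ p, x p ≤ m p) := by
    ext; simp [Pi.le_def]
  rw [boxSum, this, Finset.sum_filter]

lemma dot_oneZero (T : Tensor n) (m : Idx n) : dot T (oneZero m) = boxSum T m := by
  rw [boxSum_eq_sum_ite, dot]
  refine Finset.sum_congr rfl fun x _ => ?_
  simp [oneZero, Finset.prod_ite_zero]

lemma isNonincreasing_oneZero (m : Idx n) (p : Fin d) : IsNonincreasing (oneZero m p) := by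
  refine ⟨fun i => ?_, fun i j h => ?_⟩ <;> simp only [oneZero]
  · split_ifs <;> norm_num
  · by_cases h2 : j ≤ m p
    · simp [h2, h.trans h2]
    · simp only [h2, if_false]; split_ifs <;> norm_num

lemma boxSum_mixedDelta (T : Tensor n) : boxSum (mixedDelta T) = T := by
  ext m
  rw [← dot_oneZero, dot_mixedDelta, ← dot_single T m]
  congr 1
  ext p : 1
  exact drop_le_indicator (m p)

lemma boxSum_injective : Function.Injective (boxSum (n := n)) := by
  intro T T' h
  ext m
  induction m using WellFoundedLT.induction with
  | ind m ih =>
    have h1 := congrFun h m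
    have hm : m ∉ Finset.Iio m := by simp
    simp only [boxSum, ← Finset.Iio_insert] at h1
    rw [Finset.sum_insert hm, Finset.sum_insert hm,
      Finset.sum_congr rfl fun x hx => ih x (Finset.mem_Iio.1 hx)] at h1
    linarith

lemma mixedDelta_boxSum (T : Tensor n) : mixedDelta (boxSum T) = T :=
  boxSum_injective (boxSum_mixedDelta _)

lemma dot_eq_dot_boxSum (T : Tensor n) (a : Vectors n) :
    dot T a = dot (boxSum T) (fun p => drop (a p)) := by
  rw [← dot_mixedDelta, mixedDelta_boxSum]

lemma dot_mono {T T' : Tensor n} {a : Vectors n} (h : ∀ x, T x ≤ T' x)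
    (ha : ∀ p i, 0 ≤ a p i) : dot T a ≤ dot T' a :=
  Finset.sum_le_sum fun x _ =>
    mul_le_mul_of_nonneg_right (h x) (Finset.prod_nonneg fun p _ => ha p _)

lemma dotExcept_eq_dot (q : Fin d) (T : Tensor n) (a : Vectors n) (i : Fin (n q)) :
    dotExcept q T a i = dot T (Function.update a q (Pi.single i 1)) := by
  rw [dot_update, dotExcept]
  refine Finset.sum_congr rfl fun x _ => ?_
  rw [Pi.single_apply]
  split_ifs <;> simp

/-- A slice of a mixed derivative only needs the derivative along the sliced dimension; in the
other dimensions the derivatives pass to the vectors. -/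
lemma dotExcept_mixedDelta (q : Fin d) (T : Tensor n) (a : Vectors n) (i : Fin (n q)) :
    dotExcept q (mixedDelta T) a i =
      dot (delta q T) (Function.update (fun p => drop (a p)) q (Pi.single i 1)) := by
  rw [dotExcept_eq_dot, dot_mixedDelta, dot_delta]
  congr 1
  ext p : 1
  by_cases h : p = q
  · subst h; simp
  · simp [h]

lemma marginal_eq_dotExcept (q : Fin d) (T : Tensor n) (i : Fin (n q)) :
    marginal T q i = dotExcept q T (fun _ _ => 1) i := by
  simp [marginal, dotExcept]

/-- The index tuple that is maximal in all dimensions. -/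
def lastIdx (hn : ∀ p, 0 < n p) : Idx n := fun p => ⟨n p - 1, Nat.sub_lt (hn p) one_pos⟩

lemma marginal_mixedDelta (hn : ∀ p, 0 < n p) (q : Fin d) (T : Tensor n) (i : Fin (n q)) :
    marginal (mixedDelta T) q i = delta q T (Function.update (lastIdx hn) q i) := by
  rw [marginal_eq_dotExcept, dotExcept_mixedDelta, ← dot_single (delta q T)]
  congr 1
  ext p : 1
  by_cases h : p = q
  · subst h; simp
  · simp only [Function.update_of_ne h]
    rw [← drop_le_indicator]
    congr 1
    ext j
    have : j ≤ lastIdx hn p := Fin.le_def.2 (by simp [lastIdx]; omega)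
    simp [this]

end

/-! ### Attainment of the value tensor -/

section
variable {d : ℕ} {n : Fin d → ℕ} {f : Vectors n} {B : ℝ≥0∞} {M M' : Tensor n}

lemma mem_consistentNonneg : M ∈ consistentNonneg f B ↔
    (∀ x, 0 ≤ M x) ∧ (∀ p i, marginal M p i ≤ f p i) ∧ ∀ x, (M x : EReal) ≤ (B : EReal) :=
  Iff.rfl

lemma le_marginal (h : ∀ x, 0 ≤ M x) (p : Fin d) (x : Idx n) : M x ≤ marginal M p (x p) := by
  have h1 : M x = if x p = x p then M x else 0 := by simp
  rw [h1]
  exact Finset.single_le_sum (f := fun y : Idx n => if y p = x p then M y else 0)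
    (fun y _ => by split_ifs <;> simp [h]) (Finset.mem_univ x)

lemma zero_mem_consistentNonneg (hf : ∀ p, IsNonincreasing (f p)) :
    (0 : Tensor n) ∈ consistentNonneg f B := by
  refine ⟨fun x => le_rfl, fun p i => ?_, fun x => ?_⟩
  · simpa [marginal] using (hf p).1 i
  · simpa using EReal.coe_ennreal_nonneg B

lemma continuous_marginal (p : Fin d) (i : Fin (n p)) :
    Continuous fun M : Tensor n => marginal M p i := by
  unfold marginal
  refine continuous_finsetSum _ fun x _ => ?_
  split_ifs
  · exact continuous_apply x
  · exact continuous_const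

lemma isCompact_consistentNonneg (hd : 1 ≤ d) : IsCompact (consistentNonneg f B) := by
  have hK : IsCompact (Set.Icc (0 : Tensor n) fun x => f ⟨0, hd⟩ (x ⟨0, hd⟩)) := isCompact_Icc
  refine hK.of_isClosed_subset ?_ fun M hM => ⟨fun x => hM.1 x, fun x => ?_⟩
  · have : consistentNonneg f B = {M | ∀ x, 0 ≤ M x} ∩
        ({M | ∀ p i, marginal M p i ≤ f p i} ∩ {M | ∀ x, (M x : EReal) ≤ (B : EReal)}) := rfl
    rw [this]
    simp only [Set.ofPred_forall]
    refine IsClosed.inter (isClosed_iInter fun x => isClosed_le continuous_const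
      (continuous_apply x)) (IsClosed.inter (isClosed_iInter fun p => isClosed_iInter fun i =>
      isClosed_le (continuous_marginal p i) continuous_const) (isClosed_iInter fun x =>
      isClosed_le (continuous_coe_real_ereal.comp (continuous_apply x)) continuous_const))
  · exact (le_marginal hM.1 ⟨0, hd⟩ x).trans (hM.2.1 _ _)

lemma isGreatest_valueTensor (hd : 1 ≤ d) (hf : ∀ p, IsNonincreasing (f p)) (m : Idx n) :
    IsGreatest (boxSums f B m) (valueTensor f B m) := by
  have hc : Continuous fun M : Tensor n => ∑ s ∈ Finset.Iic m, M s :=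
    continuous_finsetSum _ fun x _ => continuous_apply x
  obtain ⟨M, hM, hmax⟩ := (isCompact_consistentNonneg hd).exists_isMaxOn
    ⟨0, zero_mem_consistentNonneg (B := B) hf⟩ hc.continuousOn
  have h : IsGreatest (boxSums f B m) (∑ s ∈ Finset.Iic m, M s) :=
    ⟨⟨M, hM, rfl⟩, by rintro _ ⟨M', hM', rfl⟩; exact hmax hM'⟩
  rw [valueTensor, h.csSup_eq]
  exact h

lemma exists_boxSum_eq (hd : 1 ≤ d) (hf : ∀ p, IsNonincreasing (f p)) (m : Idx n) :
    ∃ M ∈ consistentNonneg f B, boxSum M m = valueTensor f B m :=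
  (isGreatest_valueTensor hd hf m).1

lemma boxSum_le_valueTensor (hd : 1 ≤ d) (hf : ∀ p, IsNonincreasing (f p))
    (hM : M ∈ consistentNonneg f B) (m : Idx n) : boxSum M m ≤ valueTensor f B m :=
  (isGreatest_valueTensor hd hf m).2 ⟨M, hM, rfl⟩

lemma valueTensor_nonneg (hd : 1 ≤ d) (hf : ∀ p, IsNonincreasing (f p)) (m : Idx n) :
    0 ≤ valueTensor f B m := by
  refine le_trans ?_ (boxSum_le_valueTensor hd hf (zero_mem_consistentNonneg hf) m)
  simp [boxSum]

lemma boxSum_mono (h : ∀ x, 0 ≤ M x) {m m' : Idx n} (hm : m ≤ m') : boxSum M m ≤ boxSum M m' :=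
  Finset.sum_le_sum_of_subset_of_nonneg (Finset.Iic_subset_Iic.2 hm) fun x _ _ => h x

lemma valueTensor_mono (hd : 1 ≤ d) (hf : ∀ p, IsNonincreasing (f p)) {m m' : Idx n}
    (hm : m ≤ m') : valueTensor f B m ≤ valueTensor f B m' := by
  obtain ⟨M, hM, h⟩ := exists_boxSum_eq (B := B) hd hf m
  exact h ▸ (boxSum_mono hM.1 hm).trans (boxSum_le_valueTensor hd hf hM m')

/-! ### The value tensor along one dimension -/

lemma sum_ite_eq_marginal_le (h : ∀ x, 0 ≤ M x) (p : Fin d) (P : Idx n → Prop) [DecidablePred P]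
    (i : Fin (n p)) : (∑ x : Idx n, if x p = i ∧ P x then M x else 0) ≤ marginal M p i :=
  Finset.sum_le_sum fun x _ => by
    by_cases h1 : x p = i <;> by_cases h2 : P x <;> simp [h1, h2, h]

/-- The box sum is at most the sum over the box that is one rank smaller along dimension `q`, plus
the marginal of the missing rank. -/
lemma delta_boxSum_le (h : ∀ x, 0 ≤ M x) (q : Fin d) (x : Idx n) :
    delta q (boxSum M) x ≤ marginal M q (x q) := by
  unfold delta
  split_ifs with h0
  · rw [sub_zero, boxSum_eq_sum_ite]
    refine le_trans (Finset.sum_le_sum fun y _ => ?_)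
      (sum_ite_eq_marginal_le h q (fun y => ∀ p, y p ≤ x p) (x q))
    by_cases hy : ∀ p, y p ≤ x p
    · have : y q = x q := le_antisymm (hy q) (Fin.le_def.2 (by omega))
      simp [hy, this]
    · simp [hy]
  · rw [sub_le_iff_le_add, boxSum_eq_sum_ite, boxSum_eq_sum_ite]
    refine le_trans ?_ (add_le_add_left
      (sum_ite_eq_marginal_le h q (fun y => ∀ p, y p ≤ x p) (x q)) _)
    rw [← Finset.sum_add_distrib]
    refine Finset.sum_le_sum fun y _ => ?_
    by_cases hy : ∀ p, y p ≤ x p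
    · by_cases hq : y q = x q
      · simp only [hy, hq]; split_ifs <;> simp_all
      · have h2 : ∀ p, y p ≤ Function.update x q
            ⟨(x q).val - 1, (Nat.sub_le _ _).trans_lt (x q).isLt⟩ p := fun p => by
          by_cases hp : p = q
          · subst hp
            have h3 := Fin.le_def.1 (hy p)
            have h4 := fun e => hq (Fin.ext e)
            simp only [Function.update_self, Fin.le_def]; omega
          · rw [Function.update_of_ne hp]; exact hy p
        simp [hy, hq, h2]
    · rw [if_neg hy]
      exact add_nonneg (ite_nonneg (h y) le_rfl) (ite_nonneg (h y) le_rfl)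

lemma pred_le (x : Idx n) (q : Fin d) : Function.update x q
    ⟨(x q).val - 1, (Nat.sub_le _ _).trans_lt (x q).isLt⟩ ≤ x :=
  update_le_self_iff.2 (Fin.le_def.2 (Nat.sub_le _ _))

lemma delta_valueTensor_nonneg (hd : 1 ≤ d) (hf : ∀ p, IsNonincreasing (f p)) (q : Fin d)
    (x : Idx n) : 0 ≤ delta q (valueTensor f B) x := by
  unfold delta
  split_ifs with h0
  · simpa using valueTensor_nonneg hd hf x
  · exact sub_nonneg.2 (valueTensor_mono hd hf (pred_le x q))

lemma delta_valueTensor_le (hd : 1 ≤ d) (hf : ∀ p, IsNonincreasing (f p)) (q : Fin d)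
    (x : Idx n) : delta q (valueTensor f B) x ≤ f q (x q) := by
  obtain ⟨M, hM, h⟩ := exists_boxSum_eq (B := B) hd hf x
  refine le_trans ?_ ((delta_boxSum_le hM.1 q x).trans (hM.2.1 q _))
  unfold delta
  rw [h]
  split_ifs with h0
  · exact le_rfl
  · exact sub_le_sub_left (boxSum_le_valueTensor hd hf hM _) _

/-- Moving a slice of the index set to another rank. -/
lemma sum_ite_update (q : Fin d) (a b : Fin (n q)) (g : Idx n → ℝ) :
    (∑ x : Idx n, if x q = a then g (Function.update x q b) else 0) =
      ∑ y : Idx n, if y q = b then g y else 0 := by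
  rw [← Finset.sum_filter, ← Finset.sum_filter]
  refine Finset.sum_bij' (fun x _ => Function.update x q b) (fun y _ => Function.update y q a)
    ?_ ?_ ?_ ?_ ?_
  · simp
  · simp
  · intro x hx
    have := (Finset.mem_filter.1 hx).2
    simp [← this]
  · intro y hy
    have := (Finset.mem_filter.1 hy).2
    simp [← this]
  · simp

/-- The tensor that witnesses concavity of `V` along dimension `q`: the average of `M'` on the
ranks below `s`, and of `M` with its slice `r` merged into the slice `s`. -/
def foldSlice (q : Fin d) (r s : Fin (n q)) (M M' : Tensor n) : Tensor n := fun x =>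
  ((if x q ≤ s then M x else 0) + (if x q = s then M (Function.update x q r) else 0) +
    (if x q < s then M' x else 0)) / 2

/-- Weighted sums of `foldSlice`, for weights that ignore the rank along dimension `q`. -/
lemma sum_foldSlice (q : Fin d) (r s : Fin (n q)) (w : Idx n → ℝ)
    (hw : ∀ x j, w (Function.update x q j) = w x) :
    ∑ x, w x * foldSlice q r s M M' x =
      ((∑ x, if x q ≤ s then w x * M x else 0) + (∑ x, if x q = r then w x * M x else 0) +
        ∑ x, if x q < s then w x * M' x else 0) / 2 := by
  rw [← sum_ite_update q s r (fun x => w x * M x), ← Finset.sum_add_distrib,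
    ← Finset.sum_add_distrib, Finset.sum_div]
  refine Finset.sum_congr rfl fun x _ => ?_
  rw [hw, foldSlice]
  split_ifs <;> ring

lemma coe_half_add_le {B : ℝ≥0∞} {u v : ℝ} (hu : (u : EReal) ≤ (B : EReal))
    (hv : (v : EReal) ≤ (B : EReal)) : (((u + v) / 2 : ℝ) : EReal) ≤ (B : EReal) := by
  rcases le_total u v with h | h
  · exact (EReal.coe_le_coe_iff.2 (by linarith)).trans hv
  · exact (EReal.coe_le_coe_iff.2 (by linarith)).trans hu

lemma foldSlice_mem (hf : ∀ p, IsNonincreasing (f p)) (hM : M ∈ consistentNonneg f B)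
    (hM' : M' ∈ consistentNonneg f B) (q : Fin d) {r s : Fin (n q)} (hsr : s < r) :
    foldSlice q r s M M' ∈ consistentNonneg f B := by
  obtain ⟨h0, h1, h2⟩ := hM
  obtain ⟨h0', h1', h2'⟩ := hM'
  have hB : ((0 : ℝ) : EReal) ≤ (B : EReal) := by simpa using EReal.coe_ennreal_nonneg B
  refine ⟨fun x => ?_, fun p i => ?_, fun x => ?_⟩
  · have a1 := h0 x
    have a2 := h0' x
    have a3 := h0 (Function.update x q r)
    unfold foldSlice
    split_ifs <;> positivity
  · by_cases hp : p = q
    · subst hp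
      have e : ∀ x : Idx n, (if x p = i then foldSlice p r s M M' x else 0) =
          ((if i ≤ s then if x p = i then M x else 0 else 0) +
          (if i = s then if x p = s then M (Function.update x p r) else 0 else 0) +
          (if i < s then if x p = i then M' x else 0 else 0)) / 2 := fun x => by
        by_cases hx : x p = i
        · subst hx
          rw [if_pos rfl, foldSlice]
          by_cases h : x p = s <;> simp only [h, if_true, if_false]
        · by_cases hi : i = s
          · subst hi; simp [hx]
          · simp [hx, hi]
      rw [marginal, Finset.sum_congr rfl fun x _ => e x, ← Finset.sum_div,
        Finset.sum_add_distrib, Finset.sum_add_distrib]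
      have c1 := h1 p i
      have c2 := h1' p i
      have c3 := h1 p r
      have c4 := (hf p).1 i
      unfold marginal at c1 c2 c3
      rcases lt_trichotomy i s with hi | hi | hi
      · simp only [hi, hi.le, hi.ne, if_true, if_false, Finset.sum_const_zero]
        linarith
      · subst hi
        simp only [le_refl, lt_irrefl, if_true, if_false, Finset.sum_const_zero]
        rw [sum_ite_update p i r M]
        have := (hf p).2 hsr.le
        linarith
      · simp only [not_lt.2 hi.le, not_le.2 hi, hi.ne', if_false, Finset.sum_const_zero]
        linarith
    · have e := sum_foldSlice (M := M) (M' := M') q r s (fun x => if x p = i then 1 else 0)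
        (fun x j => by rw [Function.update_of_ne hp])
      simp only [ite_mul, one_mul, zero_mul] at e
      rw [marginal, e]
      have c1 := h1 p i
      have c2 := h1' p i
      have c3 : (∑ x : Idx n, if x q < s then if x p = i then M' x else 0 else 0) ≤
          marginal M' p i := Finset.sum_le_sum fun x _ => by
        have := h0' x
        by_cases hx : x q < s
        · rw [if_pos hx]
        · rw [if_neg hx]
          exact ite_nonneg this le_rfl
      have c4 : (∑ x : Idx n, if x q ≤ s then if x p = i then M x else 0 else 0) +
          (∑ x : Idx n, if x q = r then if x p = i then M x else 0 else 0) ≤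
          marginal M p i := by
        rw [← Finset.sum_add_distrib]
        refine Finset.sum_le_sum fun x _ => ?_
        have := h0 x
        by_cases hx : x q = r
        · rw [if_pos hx, if_neg (by rw [hx]; exact not_le.2 hsr), zero_add]
        · rw [if_neg hx, add_zero]
          by_cases hs : x q ≤ s
          · rw [if_pos hs]
          · rw [if_neg hs]
            exact ite_nonneg this le_rfl
      linarith
  · unfold foldSlice
    rcases lt_trichotomy (x q) s with hx | hx | hx
    · rw [if_pos hx.le, if_neg hx.ne, if_pos hx, add_zero]
      exact coe_half_add_le (h2 x) (h2' x)
    · rw [if_pos hx.le, if_pos hx, if_neg hx.not_lt, add_zero]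
      exact coe_half_add_le (h2 x) (h2 (Function.update x q r))
    · rw [if_neg (not_le.2 hx), if_neg hx.ne', if_neg (not_lt.2 hx.le), add_zero, add_zero,
        zero_div]
      exact hB

/-- Concavity of `V` along dimension `q`, in terms of an arbitrary tensor on the smallest box,
so that the smallest box may be empty. -/
lemma boxSum_add_le_two_mul (hd : 1 ≤ d) (hf : ∀ p, IsNonincreasing (f p))
    (hM : M ∈ consistentNonneg f B) (hM' : M' ∈ consistentNonneg f B) (q : Fin d) (x : Idx n)
    {s : Fin (n q)} (hs : s.val + 1 = (x q).val) :
    boxSum M x + (∑ y, if (∀ p, p ≠ q → y p ≤ x p) ∧ y q < s then M' y else 0) ≤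
      2 * valueTensor f B (Function.update x q s) := by
  have hsr : s < x q := Fin.lt_def.2 (by omega)
  have h := boxSum_le_valueTensor hd hf (foldSlice_mem hf hM hM' q hsr) (Function.update x q s)
  have e := sum_foldSlice (M := M) (M' := M') q (x q) s
    (fun y => if ∀ p, p ≠ q → y p ≤ x p then 1 else 0) (fun y j => by
      congr 1
      exact propext (forall_congr' fun p => imp_congr_right fun hp => by
        rw [Function.update_of_ne hp]))
  have hbox : ∀ y : Idx n, ∀ j, (∀ p, y p ≤ Function.update x q j p) ↔
      (∀ p, p ≠ q → y p ≤ x p) ∧ y q ≤ j := fun y j => by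
    constructor
    · intro hy
      exact ⟨fun p hp => by simpa [hp] using hy p, by simpa using hy q⟩
    · rintro ⟨hy, hq⟩ p
      by_cases hp : p = q
      · subst hp; simpa using hq
      · simpa [hp] using hy p hp
  have e1 : boxSum (foldSlice q (x q) s M M') (Function.update x q s) =
      ∑ y, (if ∀ p, p ≠ q → y p ≤ x p then 1 else 0) * foldSlice q (x q) s M M' y := by
    rw [boxSum_eq_sum_ite]
    refine Finset.sum_congr rfl fun y _ => ?_
    rw [if_congr (hbox y s) rfl rfl]
    by_cases hy : y q ≤ s
    · by_cases hw : ∀ p, p ≠ q → y p ≤ x p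
      · rw [if_pos ⟨hw, hy⟩, if_pos hw, one_mul]
      · rw [if_neg fun h => hw h.1, if_neg hw, zero_mul]
    · have : foldSlice q (x q) s M M' y = 0 := by
        have h1 : y q ≠ s := fun e => hy e.le
        have h2 : ¬ y q < s := fun e => hy e.le
        simp only [foldSlice, hy, h1, h2, if_false, add_zero, zero_div]
      rw [this, mul_zero, ite_self]
  have e2 : boxSum M x = (∑ y, if y q ≤ s then
      (if ∀ p, p ≠ q → y p ≤ x p then 1 else 0) * M y else 0) +
      ∑ y, if y q = x q then (if ∀ p, p ≠ q → y p ≤ x p then 1 else 0) * M y else 0 := by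
    rw [boxSum_eq_sum_ite, ← Finset.sum_add_distrib]
    refine Finset.sum_congr rfl fun y _ => ?_
    have h4 := hbox y (x q)
    rw [Function.update_eq_self] at h4
    rw [if_congr h4 rfl rfl]
    rcases lt_trichotomy (y q) (x q) with hy | hy | hy
    · have h3 : y q ≤ s := Fin.le_def.2 (by have := Fin.lt_def.1 hy; omega)
      simp [hy.ne, hy.le, h3]
    · have h3 : ¬ x q ≤ s := not_le.2 hsr
      simp [hy, h3]
    · have h3 : ¬ y q ≤ s := not_le.2 (hsr.trans hy)
      simp [hy.ne', not_le.2 hy, h3]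
  have e3 : (∑ y, if (∀ p, p ≠ q → y p ≤ x p) ∧ y q < s then M' y else 0) =
      ∑ y, if y q < s then (if ∀ p, p ≠ q → y p ≤ x p then 1 else 0) * M' y else 0 := by
    refine Finset.sum_congr rfl fun y _ => ?_
    by_cases hy : y q < s <;> simp [hy]
  rw [e1, e, ← e2, ← e3] at h
  linarith

lemma delta_delta_valueTensor_nonpos (hd : 1 ≤ d) (hf : ∀ p, IsNonincreasing (f p)) (q : Fin d)
    (x : Idx n) (hx : (x q).val ≠ 0) : delta q (delta q (valueTensor f B)) x ≤ 0 := by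
  obtain ⟨M, hM, hMx⟩ := exists_boxSum_eq (B := B) hd hf x
  have hs : (x q).val - 1 + 1 = (x q).val := by omega
  by_cases h1 : (x q).val - 1 = 0
  · have := boxSum_add_le_two_mul hd hf hM (zero_mem_consistentNonneg hf) q x
      (s := ⟨(x q).val - 1, (Nat.sub_le _ _).trans_lt (x q).isLt⟩) hs
    simp [hMx] at this
    simp [delta, hx, h1] at this ⊢
    linarith
  · obtain ⟨M', hM', hMx'⟩ := exists_boxSum_eq (B := B) hd hf (Function.update x q
      ⟨(x q).val - 1 - 1, by omega⟩)
    have := boxSum_add_le_two_mul hd hf hM hM' q x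
      (s := ⟨(x q).val - 1, (Nat.sub_le _ _).trans_lt (x q).isLt⟩) hs
    have e : (∑ y, if (∀ p, p ≠ q → y p ≤ x p) ∧
        y q < (⟨(x q).val - 1, (Nat.sub_le _ _).trans_lt (x q).isLt⟩ : Fin (n q))
          then M' y else 0) = valueTensor f B (Function.update x q
            ⟨(x q).val - 1 - 1, by omega⟩) := by
      rw [← hMx', boxSum_eq_sum_ite]
      refine Finset.sum_congr rfl fun y _ => ?_
      congr 1
      refine propext ⟨fun hy p => ?_, fun hy => ⟨fun p hp => by simpa [hp] using hy p, ?_⟩⟩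
      · by_cases hp : p = q
        · subst hp
          have := Fin.lt_def.1 hy.2
          simp only [Function.update_self, Fin.le_def] at this ⊢
          omega
        · simpa [hp] using hy.1 p hp
      · have := hy q
        simp only [Function.update_self, Fin.le_def, Fin.lt_def] at this ⊢
        omega
    rw [hMx, e] at this
    simp [delta, hx, h1] at this ⊢
    linarith

end

/-! ### Rearrangement -/

/-- A set of ranks as large as an initial segment is the image of that segment under an
injection that does not decrease ranks. -/
lemma exists_injOn_image_eq {k : ℕ} (m : Fin k) (S : Finset (Fin k))
    (hS : S.card = (Finset.Iic m).card) :
    ∃ φ : Fin k → Fin k, Set.InjOn φ (Finset.Iic m) ∧ (Finset.Iic m).image φ = S ∧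
      ∀ i ∈ Finset.Iic m, i ≤ φ i := by
  have hc : (Finset.Iic m \ S).card = (S \ Finset.Iic m).card := by
    have h1 := Finset.card_sdiff_add_card_inter (Finset.Iic m) S
    have h2 := Finset.card_sdiff_add_card_inter S (Finset.Iic m)
    rw [Finset.inter_comm] at h2
    omega
  let e := Finset.equivOfCardEq hc
  let φ : Fin k → Fin k := fun i => if h : i ∈ Finset.Iic m \ S then (e ⟨i, h⟩ : Fin k) else i
  have hin : ∀ i (h : i ∈ Finset.Iic m \ S), φ i ∈ S \ Finset.Iic m := fun i h => by
    simp only [φ, h, dif_pos]; exact (e ⟨i, h⟩).2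
  have hout : ∀ i, i ∉ Finset.Iic m \ S → φ i = i := fun i h => by
    simp only [φ, h, dif_neg, not_false_iff]
  have himg : ∀ i ∈ Finset.Iic m, φ i ∈ S := fun i hi => by
    by_cases h : i ∈ Finset.Iic m \ S
    · exact (Finset.mem_sdiff.1 (hin i h)).1
    · rw [hout i h]
      by_contra h2
      exact h (Finset.mem_sdiff.2 ⟨hi, h2⟩)
  have hinj : Set.InjOn φ (Finset.Iic m) := by
    intro i hi j hj hij
    by_cases h1 : i ∈ Finset.Iic m \ S <;> by_cases h2 : j ∈ Finset.Iic m \ S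
    · simp only [φ, h1, h2, dif_pos] at hij
      simpa using e.injective (Subtype.ext hij)
    · rw [hout j h2] at hij
      exact absurd hj (hij ▸ (Finset.mem_sdiff.1 (hin i h1)).2)
    · rw [hout i h1] at hij
      exact absurd hi (hij ▸ (Finset.mem_sdiff.1 (hin j h2)).2)
    · rwa [hout i h1, hout j h2] at hij
  refine ⟨φ, hinj, ?_, fun i hi => ?_⟩
  · refine Finset.eq_of_subset_of_card_le (Finset.image_subset_iff.2 himg) ?_
    rw [Finset.card_image_of_injOn hinj, hS]
  · by_cases h : i ∈ Finset.Iic m \ S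
    · have := (Finset.mem_sdiff.1 (hin i h)).2
      exact (Finset.mem_Iic.1 hi).trans (by simpa using this : m < φ i).le
    · rw [hout i h]

section
variable {d : ℕ} {n : Fin d → ℕ} {f : Vectors n} {B : ℝ≥0∞} {M : Tensor n}

/-- Relabelling the ranks in a box. -/
lemma sum_Iic_comp (M : Tensor n) (m : Idx n) (φ : (p : Fin d) → Fin (n p) → Fin (n p))
    (hφ : ∀ p, Set.InjOn (φ p) (Finset.Iic (m p))) :
    ∑ x ∈ Finset.Iic m, M (fun p => φ p (x p)) =
      ∑ y ∈ Fintype.piFinset fun p => (Finset.Iic (m p)).image (φ p), M y := by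
  rw [Fintype.piFinset_image (fun p => φ p), Finset.sum_image]
  · refine Finset.sum_congr ?_ fun _ _ => rfl
    ext x; simp [Pi.le_def]
  · intro x hx y hy hxy
    ext p : 1
    simp only [Finset.mem_coe, Fintype.mem_piFinset] at hx hy
    exact hφ p (hx p) (hy p) (congrFun hxy p)

/-- The box sums of all permutations of consistent tensors are bounded by `V`: the entries of the
permuted box can be moved to the box itself without decreasing any degree bound. -/
lemma boxSum_permute_le (hd : 1 ≤ d) (hf : ∀ p, IsNonincreasing (f p))
    (hM : M ∈ consistentNonneg f B) (σ : (p : Fin d) → Equiv.Perm (Fin (n p))) (m : Idx n) :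
    boxSum (permute M σ) m ≤ valueTensor f B m := by
  choose φ hinj himg hle using fun p => exists_injOn_image_eq (m p)
    ((Finset.Iic (m p)).image (σ p)) (Finset.card_image_of_injective _ (σ p).injective)
  let N : Tensor n := fun x => if ∀ p, x p ≤ m p then M (fun p => φ p (x p)) else 0
  have hN : N ∈ consistentNonneg f B := by
    obtain ⟨h0, h1, h2⟩ := hM
    refine ⟨fun x => ?_, fun p i => ?_, fun x => ?_⟩
    · simp only [N]; split_ifs
      · exact h0 _
      · exact le_rfl
    · by_cases hi : i ≤ m p
      · refine le_trans ?_ ((h1 p (φ p i)).trans ((hf p).2 (hle p i (Finset.mem_Iic.2 hi))))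
        have hinj' : Set.InjOn (fun x : Idx n => fun q => φ q (x q))
            ((Finset.univ.filter fun x : Idx n => x p = i ∧ ∀ q, x q ≤ m q : Finset (Idx n)) :
              Set (Idx n)) := by
          intro x hx y hy hxy
          ext q : 1
          simp only [Finset.coe_filter, Finset.mem_univ, true_and, Set.mem_ofPred_eq] at hx hy
          exact hinj q (by simpa using hx.2 q) (by simpa using hy.2 q) (congrFun hxy q)
        have e1 : marginal N p i = ∑ y ∈ (Finset.univ.filter
            fun x : Idx n => x p = i ∧ ∀ q, x q ≤ m q).image (fun x q => φ q (x q)), M y := by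
          rw [Finset.sum_image hinj', Finset.sum_filter, marginal]
          refine Finset.sum_congr rfl fun x _ => ?_
          by_cases hx : x p = i
          · simp [hx, N]
          · simp [hx]
        rw [e1, marginal, ← Finset.sum_filter]
        refine Finset.sum_le_sum_of_subset_of_nonneg (fun y hy => ?_) fun y _ _ => h0 y
        obtain ⟨x, hx, rfl⟩ := Finset.mem_image.1 hy
        simp [(Finset.mem_filter.1 hx).2.1]
      · have : marginal N p i = 0 := Finset.sum_eq_zero fun x _ => by
          by_cases hx : x p = i
          · have : ¬ ∀ q, x q ≤ m q := fun h => hi (hx ▸ h p)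
            simp only [N, this, if_false, ite_self]
          · simp [hx]
        rw [this]
        exact (hf p).1 i
    · simp only [N]; split_ifs
      · exact h2 _
      · simpa using EReal.coe_ennreal_nonneg B
  refine le_of_eq_of_le ?_ (boxSum_le_valueTensor hd hf hN m)
  have e1 : boxSum N m = ∑ x ∈ Finset.Iic m, M (fun p => φ p (x p)) :=
    Finset.sum_congr rfl fun x hx => by
      have : ∀ p, x p ≤ m p := Finset.mem_Iic.1 hx
      simp [N, this]
  rw [e1, sum_Iic_comp M m φ hinj]
  simp only [himg]
  exact sum_Iic_comp M m (fun p => σ p) fun p => (σ p).injective.injOn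

/-! ### The worst-case tensor -/

lemma boxSum_worstCaseTensor (f : Vectors n) (B : ℝ≥0∞) :
    boxSum (worstCaseTensor f B) = valueTensor f B :=
  boxSum_mixedDelta _

lemma eq_worstCaseTensor_of_boxSum {T : Tensor n} (h : boxSum T = valueTensor f B) :
    T = worstCaseTensor f B :=
  boxSum_injective (h.trans (boxSum_worstCaseTensor f B).symm)

lemma isWorstCaseSolution_worstCaseTensor (hd : 1 ≤ d) (hn : ∀ p, 0 < n p)
    (hf : ∀ p, IsNonincreasing (f p)) : IsWorstCaseSolution f B (worstCaseTensor f B) := by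
  refine ⟨⟨fun p i => ?_, fun x => ?_⟩, fun σ M hM a ha => ?_⟩
  · have h := delta_valueTensor_le (B := B) hd hf p (Function.update (lastIdx hn) p i)
    rw [Function.update_self] at h
    exact (marginal_mixedDelta hn p (valueTensor f B) i).trans_le h
  · simp
  · rw [dot_eq_dot_boxSum, dot_eq_dot_boxSum (worstCaseTensor f B), boxSum_worstCaseTensor]
    exact dot_mono (boxSum_permute_le hd hf hM σ) fun p => drop_nonneg (ha p)

lemma eq_worstCaseTensor_of_isWorstCaseSolution (hd : 1 ≤ d) (hf : ∀ p, IsNonincreasing (f p))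
    {T : Tensor n} (hT : T ∈ consistentNonneg f B) (h : IsWorstCaseSolution f B T) :
    T = worstCaseTensor f B := by
  refine eq_worstCaseTensor_of_boxSum (funext fun m => le_antisymm
    (boxSum_le_valueTensor hd hf hT m) ?_)
  obtain ⟨M, hM, e⟩ := exists_boxSum_eq (B := B) hd hf m
  rw [← e, ← dot_oneZero, ← dot_oneZero]
  exact h.2 (fun _ => Equiv.refl _) M hM _ (isNonincreasing_oneZero m)

lemma antitone_of_succ {k : ℕ} {g : Fin k → ℝ}
    (h : ∀ i j : Fin k, i.val + 1 = j.val → g j ≤ g i) : Antitone g := by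
  have key : ∀ t (i j : Fin k), j.val = i.val + t → g j ≤ g i := by
    intro t
    induction t with
    | zero => intro i j hij; rw [Fin.ext hij]
    | succ t ih =>
      intro i j hij
      have := j.isLt
      exact (h ⟨i.val + t, by omega⟩ j hij.symm).trans (ih i ⟨i.val + t, by omega⟩ rfl)
  intro i j hij
  exact key (j.val - i.val) i j (by have := Fin.le_def.1 hij; omega)

lemma dot_update_nonneg_of_single {T : Tensor n} (q : Fin d) {a : Vectors n}
    (ha : ∀ p, p ≠ q → ∀ i, 0 ≤ a p i) (i : Fin (n q)) (hT : ∀ x, x q = i → 0 ≤ T x) :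
    0 ≤ dot T (Function.update a q (Pi.single i 1)) := by
  rw [dot_update]
  refine Finset.sum_nonneg fun x _ => ?_
  rw [Pi.single_apply]
  split_ifs with h
  · exact mul_nonneg (hT x h) (mul_nonneg zero_le_one
      (Finset.prod_nonneg fun p hp => ha p (Finset.ne_of_mem_erase hp) _))
  · simp

lemma dot_update_sub (T : Tensor n) (q : Fin d) (a : Vectors n) (b c : Fin (n q) → ℝ) :
    dot T (Function.update a q (b - c)) =
      dot T (Function.update a q b) - dot T (Function.update a q c) := by
  simp only [dot_update, ← Finset.sum_sub_distrib]
  exact Finset.sum_congr rfl fun x _ => by simp only [Pi.sub_apply]; ring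

lemma dot_neg_left (T : Tensor n) (a : Vectors n) : dot (-T) a = -dot T a := by
  simp [dot]

lemma isNonincreasing_dotExcept (hd : 1 ≤ d) (hf : ∀ p, IsNonincreasing (f p)) (q : Fin d)
    (a : Vectors n) (ha : ∀ p, p ≠ q → IsNonincreasing (a p)) :
    IsNonincreasing (dotExcept q (worstCaseTensor f B) a) := by
  have ha' : ∀ p, p ≠ q → ∀ i, 0 ≤ drop (a p) i := fun p hp => drop_nonneg (ha p hp)
  have e : ∀ i, dotExcept q (worstCaseTensor f B) a i = dot (delta q (valueTensor f B))
      (Function.update (fun p => drop (a p)) q (Pi.single i 1)) :=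
    dotExcept_mixedDelta q (valueTensor f B) a
  refine ⟨fun i => ?_, antitone_of_succ fun i j hij => ?_⟩
  · rw [e]
    exact dot_update_nonneg_of_single q ha' i fun x _ => delta_valueTensor_nonneg hd hf q x
  · have h := dot_update_nonneg_of_single (T := -delta q (delta q (valueTensor f B))) q ha' j
      fun x hx => neg_nonneg.2 (delta_delta_valueTensor_nonpos hd hf q x (by rw [hx]; omega))
    rw [dot_neg_left, dot_delta, Function.update_self, Function.update_idem,
      drop_single_succ i j hij, dot_update_sub] at h
    rw [e, e]
    linarith

end

/-! ### Minimum cuts for two dimensions -/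

section
variable {α β : Type*} {P A A' P' : Finset α} {Q D D' Q' : Finset β} {r : α → ℝ} {c : β → ℝ}
  {b : ℝ} {M : α → β → ℝ}

/-- Matrices with entries in `[0, b]` whose row and column sums over `P × Q` are bounded by `r` and
by `c`; they are the flows from the rows to the columns in a complete bipartite network. -/
structure IsFlow (P : Finset α) (Q : Finset β) (r : α → ℝ) (c : β → ℝ) (b : ℝ)
    (M : α → β → ℝ) : Prop where
  nonneg : ∀ x y, 0 ≤ M x y
  le : ∀ x y, M x y ≤ b
  row : ∀ x ∈ P, ∑ y ∈ Q, M x y ≤ r x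
  col : ∀ y ∈ Q, ∑ x ∈ P, M x y ≤ c y

variable [DecidableEq β]

/-- Change column `y₀` of a matrix by `u`. -/
def bump (M : α → β → ℝ) (u : α → ℝ) (y₀ : β) : α → β → ℝ :=
  fun x y => M x y + if y = y₀ then u x else 0

lemma bump_row (u : α → ℝ) {y₀ : β} (hy : y₀ ∈ Q) (x : α) :
    ∑ y ∈ Q, bump M u y₀ x y = ∑ y ∈ Q, M x y + u x := by
  simp [bump, Finset.sum_add_distrib, hy]

lemma bump_col (u : α → ℝ) (y₀ y : β) :
    ∑ x ∈ P, bump M u y₀ x y = ∑ x ∈ P, M x y + if y = y₀ then ∑ x ∈ P, u x else 0 := by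
  simp only [bump, Finset.sum_add_distrib]
  split_ifs <;> simp

lemma bump_total (u : α → ℝ) {y₀ : β} (hy : y₀ ∈ Q) :
    ∑ x ∈ P, ∑ y ∈ Q, bump M u y₀ x y = ∑ x ∈ P, ∑ y ∈ Q, M x y + ∑ x ∈ P, u x := by
  simp [bump_row u hy, Finset.sum_add_distrib]

lemma IsFlow.bump (h : IsFlow P Q r c b M) {u : α → ℝ} {y₀ : β} (hy : y₀ ∈ Q)
    (h0 : ∀ x, 0 ≤ M x y₀ + u x) (hb : ∀ x, M x y₀ + u x ≤ b)
    (hr : ∀ x ∈ P, ∑ y ∈ Q, M x y + u x ≤ r x) (hc : ∑ x ∈ P, M x y₀ + ∑ x ∈ P, u x ≤ c y₀) :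
    IsFlow P Q r c b (bump M u y₀) := by
  refine ⟨fun x y => ?_, fun x y => ?_, fun x hx => ?_, fun y hy' => ?_⟩
  · unfold StarQuery.bump
    split_ifs with e
    · rw [e]; exact h0 x
    · simpa using h.nonneg x y
  · unfold StarQuery.bump
    split_ifs with e
    · rw [e]; exact hb x
    · simpa using h.le x y
  · rw [bump_row u hy]; exact hr x hx
  · rw [bump_col]
    split_ifs with e
    · rw [e]; exact hc
    · simpa using h.col y hy'

variable [DecidableEq α]

/-- The capacity of the cut with the rows `A` on the source side and the columns `D` on the
sink side. -/
def cut (P : Finset α) (Q : Finset β) (r : α → ℝ) (c : β → ℝ) (b : ℝ) (A : Finset α)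
    (D : Finset β) : ℝ :=
  ∑ x ∈ P \ A, r x + ∑ y ∈ Q \ D, c y + b * (A.card * D.card)

lemma total_eq_split (hA : A ⊆ P) (hD : D ⊆ Q) (M : α → β → ℝ) :
    ∑ x ∈ P, ∑ y ∈ Q, M x y = ∑ x ∈ P \ A, ∑ y ∈ Q, M x y + ∑ y ∈ Q \ D, ∑ x ∈ A, M x y +
      ∑ x ∈ A, ∑ y ∈ D, M x y := by
  rw [← Finset.sum_sdiff hA, Finset.sum_comm (s := Q \ D), add_assoc, ← Finset.sum_add_distrib]
  congr 1
  exact Finset.sum_congr rfl fun x _ => (Finset.sum_sdiff hD).symm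

lemma IsFlow.total_le_cut (h : IsFlow P Q r c b M) (hA : A ⊆ P) (hD : D ⊆ Q) :
    ∑ x ∈ P, ∑ y ∈ Q, M x y ≤ cut P Q r c b A D := by
  rw [total_eq_split hA hD, cut]
  refine add_le_add (add_le_add (Finset.sum_le_sum fun x hx => h.row x (Finset.mem_sdiff.1 hx).1)
    (Finset.sum_le_sum fun y hy => (Finset.sum_le_sum_of_subset_of_nonneg hA
      fun x _ _ => h.nonneg x y).trans (h.col y (Finset.mem_sdiff.1 hy).1))) ?_
  calc ∑ x ∈ A, ∑ y ∈ D, M x y ≤ ∑ x ∈ A, ∑ y ∈ D, b :=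
        Finset.sum_le_sum fun x _ => Finset.sum_le_sum fun y _ => h.le x y
    _ = b * (A.card * D.card) := by simp; ring

/-- Maximum flow equals minimum cut. Among the maximum flows, one with as few saturated rows as
possible leaves no augmenting path of length one and no path of length two that would free another
row, so the unsaturated rows and the columns that they fill completely form a cut of the
same value. -/
lemma exists_cut_eq {M₀ : α → β → ℝ} (h₀ : IsFlow P Q r c b M₀)
    (hmax : ∀ M, IsFlow P Q r c b M → ∑ x ∈ P, ∑ y ∈ Q, M x y ≤ ∑ x ∈ P, ∑ y ∈ Q, M₀ x y) :
    ∃ A ⊆ P, ∃ D ⊆ Q, ∑ x ∈ P, ∑ y ∈ Q, M₀ x y = cut P Q r c b A D := by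
  let sat : (α → β → ℝ) → Finset α := fun M => P.filter fun x => ¬ ∑ y ∈ Q, M x y < r x
  let S : Set (α → β → ℝ) :=
    {M | IsFlow P Q r c b M ∧ ∑ x ∈ P, ∑ y ∈ Q, M x y = ∑ x ∈ P, ∑ y ∈ Q, M₀ x y}
  obtain ⟨M, hMS, hmin⟩ : ∃ M ∈ S, ∀ M' ∈ S, (sat M).card ≤ (sat M').card := by
    have hS : S.Nonempty := ⟨M₀, h₀, rfl⟩
    exact ⟨Function.argminOn (fun M => (sat M).card) S hS, Function.argminOn_mem _ _ _,
      fun M' hM' => Function.argminOn_le (fun M => (sat M).card) S hM'⟩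
  obtain ⟨hM, htot⟩ := hMS
  let A := P.filter fun x => ∑ y ∈ Q, M x y < r x
  let D := Q.filter fun y => ∀ x ∈ A, M x y = b
  have hA : A ⊆ P := Finset.filter_subset _ _
  have hD : D ⊆ Q := Finset.filter_subset _ _
  have hrow : ∀ x ∈ P \ A, ∑ y ∈ Q, M x y = r x := fun x hx => by
    obtain ⟨h1, h2⟩ := Finset.mem_sdiff.1 hx
    by_contra h3
    exact h2 (Finset.mem_filter.2 ⟨h1, lt_of_le_of_ne (hM.row x h1) h3⟩)
  -- every column outside `D` can still be filled from some unsaturated row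
  have hfree : ∀ y ∈ Q \ D, y ∈ Q ∧ ∃ x ∈ A, M x y < b := fun y hy => by
    obtain ⟨h1, h2⟩ := Finset.mem_sdiff.1 hy
    refine ⟨h1, ?_⟩
    by_contra! h3
    exact h2 (Finset.mem_filter.2 ⟨h1, fun x hx => le_antisymm (hM.le x y) (h3 x hx)⟩)
  have hcol : ∀ y ∈ Q \ D, ∑ x ∈ P, M x y = c y := fun y hy => by
    obtain ⟨hyQ, x, hx, hxy⟩ := hfree y hy
    obtain ⟨hxP, hxr⟩ := Finset.mem_filter.1 hx
    by_contra hne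
    have hlt := lt_of_le_of_ne (hM.col y hyQ) hne
    obtain ⟨ε, hε, hε'⟩ : ∃ ε > 0, ε < min (min (r x - ∑ y ∈ Q, M x y) (b - M x y))
        (c y - ∑ x ∈ P, M x y) :=
      exists_between (lt_min (lt_min (sub_pos.2 hxr) (sub_pos.2 hxy)) (sub_pos.2 hlt))
    obtain ⟨⟨e1, e2⟩, e3⟩ : (ε < r x - ∑ y ∈ Q, M x y ∧ ε < b - M x y) ∧
        ε < c y - ∑ x ∈ P, M x y := by simpa only [lt_min_iff] using hε'
    have hsum : ∑ z ∈ P, (Pi.single x ε : α → ℝ) z = ε := by simp [hxP]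
    have hfl := hM.bump (u := Pi.single x ε) hyQ (fun z => by
        have := hM.nonneg z y
        rw [Pi.single_apply]; split_ifs <;> linarith) (fun z => by
        have := hM.le z y
        rw [Pi.single_apply]; split_ifs with e
        · rw [e]; linarith
        · linarith) (fun z hz => by
        have := hM.row z hz
        rw [Pi.single_apply]; split_ifs with e
        · rw [e]; linarith
        · linarith) (by rw [hsum]; linarith)
    have := hmax _ hfl
    rw [bump_total _ hyQ, hsum] at this
    linarith
  have hzero : ∀ y ∈ Q \ D, ∀ z ∈ P \ A, M z y = 0 := fun y hy z hz => by
    obtain ⟨hyQ, x, hx, hxy⟩ := hfree y hy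
    obtain ⟨hxP, hxr⟩ := Finset.mem_filter.1 hx
    obtain ⟨hzP, hzA⟩ := Finset.mem_sdiff.1 hz
    have hxz : x ≠ z := fun e => hzA (e ▸ hx)
    by_contra hne
    have hpos := lt_of_le_of_ne (hM.nonneg z y) (Ne.symm hne)
    obtain ⟨ε, hε, hε'⟩ : ∃ ε > 0, ε < min (min (r x - ∑ y ∈ Q, M x y) (b - M x y)) (M z y) :=
      exists_between (lt_min (lt_min (sub_pos.2 hxr) (sub_pos.2 hxy)) hpos)
    obtain ⟨⟨e1, e2⟩, e3⟩ : (ε < r x - ∑ y ∈ Q, M x y ∧ ε < b - M x y) ∧ ε < M z y := by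
      simpa only [lt_min_iff] using hε'
    let u : α → ℝ := fun w => if w = x then ε else if w = z then -ε else 0
    have hsum : ∑ w ∈ P, u w = 0 := by
      have : ∀ w, u w = (Pi.single x ε : α → ℝ) w - (Pi.single z ε : α → ℝ) w := fun w => by
        simp only [u, Pi.single_apply]
        split_ifs with h1 h2 <;> simp_all
      simp [this, hxP, hzP]
    have hfl := hM.bump (u := u) hyQ (fun w => by
        have := hM.nonneg w y
        simp only [u]; split_ifs with h1 h2
        · linarith
        · rw [h2]; linarith
        · linarith) (fun w => by
        have := hM.le w y
        simp only [u]; split_ifs with h1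
        · rw [h1]; linarith
        · linarith
        · linarith) (fun w hw => by
        have := hM.row w hw
        simp only [u]; split_ifs with h1
        · rw [h1]; linarith
        · linarith
        · linarith) (by rw [hsum, add_zero]; exact hM.col y hyQ)
    have hlt : sat (bump M u y) ⊂ sat M := by
      rw [Finset.ssubset_iff_of_subset]
      · refine ⟨z, Finset.mem_filter.2 ⟨hzP, (hrow z hz).not_lt⟩, fun h => ?_⟩
        refine (Finset.mem_filter.1 h).2 ?_
        rw [bump_row u hyQ, hrow z hz]
        simp only [u, hxz.symm, if_false, if_true]
        linarith
      · intro w hw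
        obtain ⟨hwP, hw⟩ := Finset.mem_filter.1 hw
        refine Finset.mem_filter.2 ⟨hwP, fun h => hw ?_⟩
        rw [bump_row u hyQ]
        simp only [u]; split_ifs with h1
        · rw [h1]; linarith
        · linarith
        · linarith
    have h2 := hmin _ ⟨hfl, by rw [bump_total u hyQ, hsum, add_zero, htot]⟩
    exact absurd (Finset.card_lt_card hlt) (not_lt.2 h2)
  refine ⟨A, hA, D, hD, ?_⟩
  rw [← htot, total_eq_split hA hD, cut, Finset.sum_congr rfl hrow]
  congr 1
  · congr 1
    refine Finset.sum_congr rfl fun y hy => ?_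
    rw [← hcol y hy, ← Finset.sum_sdiff hA, Finset.sum_eq_zero (hzero y hy), zero_add]
  · have hb : ∑ x ∈ A, ∑ y ∈ D, M x y = ∑ x ∈ A, ∑ y ∈ D, b :=
      Finset.sum_congr rfl fun x hx => Finset.sum_congr rfl fun y hy =>
        (Finset.mem_filter.1 hy).2 x hx
    rw [hb]
    simp only [Finset.sum_const, nsmul_eq_mul]
    ring

/-- Uncrossing: two cuts of the larger and of the smaller box give cuts of the two mixed boxes. -/
lemma cut_uncross (hb : 0 ≤ b) (hP : P' ⊆ P) (hQ : Q' ⊆ Q) (hA : A ⊆ P) (hD : D ⊆ Q)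
    (hA' : A' ⊆ P') (hD' : D' ⊆ Q') :
    cut P' Q r c b (A ∩ A') (D ∪ D') + cut P Q' r c b (A ∪ A') (D ∩ D') ≤
      cut P Q r c b A D + cut P' Q' r c b A' D' := by
  unfold cut
  rw [Finset.sum_sdiff_eq_sub (f := r) (Finset.inter_subset_right.trans hA'),
    Finset.sum_sdiff_eq_sub (f := r) (Finset.union_subset hA (hA'.trans hP)),
    Finset.sum_sdiff_eq_sub (f := r) hA, Finset.sum_sdiff_eq_sub (f := r) hA',
    Finset.sum_sdiff_eq_sub (f := c) (Finset.union_subset hD (hD'.trans hQ)),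
    Finset.sum_sdiff_eq_sub (f := c) (Finset.inter_subset_right.trans hD'),
    Finset.sum_sdiff_eq_sub (f := c) hD, Finset.sum_sdiff_eq_sub (f := c) hD']
  have e1 := Finset.sum_union_inter (s₁ := A) (s₂ := A') (f := r)
  have e2 := Finset.sum_union_inter (s₁ := D) (s₂ := D') (f := c)
  have c1 : ((A ∪ A').card : ℝ) + (A ∩ A').card = A.card + A'.card := by
    exact_mod_cast Finset.card_union_add_card_inter A A'
  have c2 : ((D ∪ D').card : ℝ) + (D ∩ D').card = D.card + D'.card := by
    exact_mod_cast Finset.card_union_add_card_inter D D'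
  have i1 : ((A ∩ A').card : ℝ) ≤ A.card := by
    exact_mod_cast Finset.card_le_card Finset.inter_subset_left
  have i2 : ((A ∩ A').card : ℝ) ≤ A'.card := by
    exact_mod_cast Finset.card_le_card Finset.inter_subset_right
  have i3 : ((D ∩ D').card : ℝ) ≤ D.card := by
    exact_mod_cast Finset.card_le_card Finset.inter_subset_left
  have i4 : ((D ∩ D').card : ℝ) ≤ D'.card := by
    exact_mod_cast Finset.card_le_card Finset.inter_subset_right
  have main : ((A ∩ A').card : ℝ) * (D ∪ D').card + (A ∪ A').card * (D ∩ D').card ≤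
      A.card * D.card + A'.card * D'.card := by
    have u1 := eq_sub_of_add_eq c1
    have u2 := eq_sub_of_add_eq c2
    rw [u1, u2]
    have p1 := mul_nonneg (sub_nonneg.2 i1) (sub_nonneg.2 i3)
    have p2 := mul_nonneg (sub_nonneg.2 i2) (sub_nonneg.2 i4)
    linarith
  have := mul_le_mul_of_nonneg_left main hb
  linarith

end

section
variable {n : Fin 2 → ℕ} {f : Vectors n} {b : ℝ≥0}

/-- The index tuple of a matrix entry. -/
def pair (i : Fin (n 0)) (j : Fin (n 1)) : Idx n :=
  (piFinTwoEquiv fun p => Fin (n p)).symm (i, j)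

@[simp] lemma pair_zero (i : Fin (n 0)) (j : Fin (n 1)) : pair i j 0 = i := rfl

@[simp] lemma pair_one (i : Fin (n 0)) (j : Fin (n 1)) : pair i j 1 = j := rfl

lemma sum_eq_sum_pair (g : Idx n → ℝ) : ∑ x, g x = ∑ i, ∑ j, g (pair i j) := by
  rw [← Fintype.sum_prod_type', ← (piFinTwoEquiv fun p => Fin (n p)).symm.sum_comp]
  rfl

lemma marginal_pair_zero (M : Tensor n) (i : Fin (n 0)) :
    marginal M 0 i = ∑ j, M (pair i j) := by
  rw [marginal, sum_eq_sum_pair]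
  simp only [pair_zero]
  rw [Finset.sum_eq_single i] <;> simp +contextual

lemma marginal_pair_one (M : Tensor n) (j : Fin (n 1)) :
    marginal M 1 j = ∑ i, M (pair i j) := by
  rw [marginal, sum_eq_sum_pair]
  simp only [pair_one]
  refine Finset.sum_congr rfl fun i _ => ?_
  rw [Finset.sum_eq_single j] <;> simp +contextual

lemma boxSum_pair (M : Tensor n) (m : Idx n) :
    boxSum M m = ∑ i ∈ Finset.Iic (m 0), ∑ j ∈ Finset.Iic (m 1), M (pair i j) := by
  have h0 : Finset.Iic (m 0) = Finset.univ.filter (· ≤ m 0) := by ext; simp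
  have h1 : Finset.Iic (m 1) = Finset.univ.filter (· ≤ m 1) := by ext; simp
  rw [boxSum_eq_sum_ite, sum_eq_sum_pair, h0, h1, Finset.sum_filter]
  refine Finset.sum_congr rfl fun i _ => ?_
  rw [Finset.sum_filter]
  by_cases hi : i ≤ m 0 <;> simp [Fin.forall_fin_two, hi]

lemma coe_le_coe_iff {t : ℝ} : (t : EReal) ≤ ((b : ℝ≥0∞) : EReal) ↔ t ≤ b := by
  rw [← EReal.coe_le_coe_iff]; rfl

/-- The cuts of the network for the box below `m`. -/
abbrev boxCut (f : Vectors n) (b : ℝ) (m : Idx n) : Finset (Fin (n 0)) → Finset (Fin (n 1)) → ℝ :=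
  cut (Finset.Iic (m 0)) (Finset.Iic (m 1)) (f 0) (f 1) b

lemma isFlow_of_mem {M : Tensor n} (hM : M ∈ consistentNonneg f b) (m : Idx n) :
    IsFlow (Finset.Iic (m 0)) (Finset.Iic (m 1)) (f 0) (f 1) b fun i j => M (pair i j) where
  nonneg _ _ := hM.1 _
  le _ _ := coe_le_coe_iff.1 (hM.2.2 _)
  row i _ := (Finset.sum_le_sum_of_subset_of_nonneg (Finset.subset_univ _)
    fun _ _ _ => hM.1 _).trans ((marginal_pair_zero M i).symm.trans_le (hM.2.1 0 i))
  col j _ := (Finset.sum_le_sum_of_subset_of_nonneg (Finset.subset_univ _)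
    fun _ _ _ => hM.1 _).trans ((marginal_pair_one M j).symm.trans_le (hM.2.1 1 j))

lemma valueTensor_le_cut (hf : ∀ p, IsNonincreasing (f p)) (m : Idx n)
    {A : Finset (Fin (n 0))} {D : Finset (Fin (n 1))} (hA : A ⊆ Finset.Iic (m 0))
    (hD : D ⊆ Finset.Iic (m 1)) : valueTensor f b m ≤ boxCut f b m A D := by
  obtain ⟨M, hM, h⟩ := exists_boxSum_eq (B := b) one_le_two hf m
  rw [← h, boxSum_pair]
  exact (isFlow_of_mem hM m).total_le_cut hA hD

lemma exists_valueTensor_eq_cut (hf : ∀ p, IsNonincreasing (f p)) (m : Idx n) :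
    ∃ A ⊆ Finset.Iic (m 0), ∃ D ⊆ Finset.Iic (m 1), valueTensor f b m = boxCut f b m A D := by
  obtain ⟨M, hM, h⟩ := exists_boxSum_eq (B := b) one_le_two hf m
  rw [← h, boxSum_pair]
  refine exists_cut_eq (isFlow_of_mem hM m) fun N hN => ?_
  rw [← boxSum_pair, h]
  let T : Tensor n := fun x => if x 0 ≤ m 0 then if x 1 ≤ m 1 then N (x 0) (x 1) else 0 else 0
  have h0 : Finset.Iic (m 0) = Finset.univ.filter (· ≤ m 0) := by ext; simp
  have h1 : Finset.Iic (m 1) = Finset.univ.filter (· ≤ m 1) := by ext; simp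
  have hT : T ∈ consistentNonneg f b := by
    refine ⟨fun x => ?_, fun p i => ?_, fun x => coe_le_coe_iff.2 ?_⟩
    · have := hN.nonneg (x 0) (x 1)
      simp only [T]; split_ifs <;> first | exact this | exact le_rfl
    · match p, i with
      | 0, i =>
        rw [marginal_pair_zero]
        by_cases hi : i ≤ m 0
        · refine le_of_eq_of_le ?_ (hN.row i (Finset.mem_Iic.2 hi))
          rw [h1, Finset.sum_filter]
          exact Finset.sum_congr rfl fun j _ => by by_cases hj : j ≤ m 1 <;> simp [T, hi, hj]
        · simpa [T, hi] using (hf 0).1 i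
      | 1, j =>
        rw [marginal_pair_one]
        by_cases hj : j ≤ m 1
        · refine le_of_eq_of_le ?_ (hN.col j (Finset.mem_Iic.2 hj))
          rw [h0, Finset.sum_filter]
          exact Finset.sum_congr rfl fun i _ => by by_cases hi : i ≤ m 0 <;> simp [T, hi, hj]
        · simpa [T, hj] using (hf 1).1 j
    · have := hN.le (x 0) (x 1)
      simp only [T]; split_ifs
      · exact this
      · exact b.2
      · exact b.2
  refine le_of_eq_of_le ?_ (boxSum_le_valueTensor one_le_two hf hT m)
  rw [boxSum_pair]
  refine Finset.sum_congr rfl fun i hi => Finset.sum_congr rfl fun j hj => ?_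
  simp [T, Finset.mem_Iic.1 hi, Finset.mem_Iic.1 hj]

/-- The value tensor of two dimensions has increasing differences. -/
lemma valueTensor_supermodular (hf : ∀ p, IsNonincreasing (f p)) (m : Idx n) {i : Fin (n 0)}
    {j : Fin (n 1)} (hi : i ≤ m 0) (hj : j ≤ m 1) :
    valueTensor f b (pair i (m 1)) + valueTensor f b (pair (m 0) j) ≤
      valueTensor f b m + valueTensor f b (pair i j) := by
  obtain ⟨A, hA, D, hD, h⟩ := exists_valueTensor_eq_cut (b := b) hf m
  obtain ⟨A', hA', D', hD', h'⟩ := exists_valueTensor_eq_cut (b := b) hf (pair i j)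
  have hP : Finset.Iic i ⊆ Finset.Iic (m 0) := Finset.Iic_subset_Iic.2 hi
  have hQ : Finset.Iic j ⊆ Finset.Iic (m 1) := Finset.Iic_subset_Iic.2 hj
  rw [h, h']
  refine le_trans (add_le_add
    (valueTensor_le_cut hf (pair i (m 1)) (A := A ∩ A') (D := D ∪ D')
      (Finset.inter_subset_right.trans hA') (Finset.union_subset hD (hD'.trans hQ)))
    (valueTensor_le_cut hf (pair (m 0) j) (A := A ∪ A') (D := D ∩ D')
      (Finset.union_subset hA (hA'.trans hP)) (Finset.inter_subset_right.trans hD'))) ?_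
  exact cut_uncross b.2 hP hQ hA hD hA' hD'

end

section
variable {d : ℕ} {n : Fin d → ℕ} {f : Vectors n}

/-- Bounds above all the degrees are vacuous. -/
lemma worstCaseTensor_top_eq (hd : 1 ≤ d) (k : ℝ≥0) (hk : ∀ p i, f p i ≤ k) :
    worstCaseTensor f ∞ = worstCaseTensor f k := by
  have h : consistentNonneg f ∞ = consistentNonneg f k := by
    ext M
    simp only [mem_consistentNonneg]
    refine and_congr_right fun h0 => and_congr_right fun h1 => ?_
    simp only [coe_le_coe_iff]
    refine ⟨fun _ x => ?_, fun _ x => by simp⟩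
    exact (le_marginal h0 ⟨0, hd⟩ x).trans ((h1 _ _).trans (hk _ _))
  unfold worstCaseTensor valueTensor boxSums
  rw [h]

lemma exists_nat_bound (f : Vectors n) : ∃ k : ℕ, ∀ p i, f p i ≤ k := by
  obtain ⟨k, hk⟩ := exists_nat_ge (∑ p, ∑ i, |f p i|)
  refine ⟨k, fun p i => le_trans ?_ hk⟩
  calc f p i ≤ |f p i| := le_abs_self _
    _ ≤ ∑ i, |f p i| :=
      Finset.single_le_sum (f := fun i => |f p i|) (fun _ _ => abs_nonneg _) (Finset.mem_univ i)
    _ ≤ ∑ p, ∑ i, |f p i| :=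
      Finset.single_le_sum (f := fun p => ∑ i, |f p i|)
        (fun _ _ => Finset.sum_nonneg fun _ _ => abs_nonneg _) (Finset.mem_univ p)

lemma foldr_delta_isInt {T : Tensor n} (hT : ∀ x, ∃ k : ℤ, T x = k) (l : List (Fin d)) :
    ∀ x, ∃ k : ℤ, l.foldr delta T x = k := by
  induction l with
  | nil => exact hT
  | cons p l ih =>
    intro x
    rw [List.foldr_cons, delta]
    obtain ⟨k, hk⟩ := ih x
    split_ifs with h
    · exact ⟨k, by rw [hk, sub_zero]⟩
    · obtain ⟨k', hk'⟩ := ih (Function.update x p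
        ⟨(x p).val - 1, (Nat.sub_le _ _).trans_lt (x p).isLt⟩)
      exact ⟨k - k', by rw [hk, hk']; push_cast; ring⟩

lemma sum_isInt {ι : Type*} (s : Finset ι) {g : ι → ℝ} (h : ∀ i, ∃ k : ℤ, g i = k) :
    ∃ k : ℤ, ∑ i ∈ s, g i = k := by
  choose k hk using h
  exact ⟨∑ i ∈ s, k i, by simp [hk]⟩

end

section
variable {n : Fin 2 → ℕ} {f : Vectors n} {B : ℝ≥0∞}

lemma worstCaseTensor_nonneg_of_finite (hf : ∀ p, IsNonincreasing (f p)) (b : ℝ≥0) (x : Idx n) :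
    0 ≤ worstCaseTensor f b x := by
  have e : worstCaseTensor f b x = delta 0 (delta 1 (valueTensor f b)) x := rfl
  have hx : pair (x 0) (x 1) = x := by ext p : 1; fin_cases p <;> rfl
  have u0 : ∀ i, Function.update x 0 i = pair i (x 1) := fun i => by
    ext p : 1; fin_cases p <;> simp
  have u1 : ∀ j, Function.update x 1 j = pair (x 0) j := fun j => by
    ext p : 1; fin_cases p <;> simp
  have u2 : ∀ i j k, Function.update (pair (n := n) i j) 1 k = pair i k := fun i j k => by
    ext p : 1; fin_cases p <;> simp
  have u3 : ∀ i j, delta 1 (valueTensor f b) (pair i j) = valueTensor f b (pair i j) -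
      if j.val = 0 then 0 else
        valueTensor f b (pair i ⟨j.val - 1, (Nat.sub_le _ _).trans_lt j.isLt⟩) := fun i j => by
    rw [← u2 i j ⟨j.val - 1, (Nat.sub_le _ _).trans_lt j.isLt⟩]; rfl
  rw [e, delta]
  split_ifs with h0
  · rw [sub_zero]; exact delta_valueTensor_nonneg one_le_two hf 1 x
  · rw [u0, u3, delta, u1]
    by_cases h1 : (x 1).val = 0
    · have := delta_valueTensor_nonneg (B := b) one_le_two hf 0 x
      rw [delta, if_neg h0, u0] at this
      simpa [h1] using this
    · have := valueTensor_supermodular (b := b) hf x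
        (i := ⟨(x 0).val - 1, (Nat.sub_le _ _).trans_lt (x 0).isLt⟩)
        (j := ⟨(x 1).val - 1, (Nat.sub_le _ _).trans_lt (x 1).isLt⟩)
        (Fin.le_def.2 (Nat.sub_le _ _)) (Fin.le_def.2 (Nat.sub_le _ _))
      rw [if_neg h1, if_neg h1]
      linarith

lemma worstCaseTensor_two_nonneg (hf : ∀ p, IsNonincreasing (f p)) (x : Idx n) :
    0 ≤ worstCaseTensor f B x := by
  induction B with
  | top =>
    obtain ⟨k, hk⟩ := exists_nat_bound f
    rw [worstCaseTensor_top_eq one_le_two k hk]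
    exact worstCaseTensor_nonneg_of_finite hf k x
  | coe b => exact worstCaseTensor_nonneg_of_finite hf b x

lemma worstCaseTensor_isInt_of_finite (hf : ∀ p, IsNonincreasing (f p))
    (hint : ∀ p i, ∃ k : ℤ, f p i = k) (b : ℕ) (x : Idx n) :
    ∃ k : ℤ, worstCaseTensor f ((b : ℝ≥0) : ℝ≥0∞) x = k := by
  refine foldr_delta_isInt (fun m => ?_) _ x
  obtain ⟨A, -, D, -, h⟩ := exists_valueTensor_eq_cut (b := b) hf m
  obtain ⟨k, hk⟩ := sum_isInt (Finset.Iic (m 0) \ A) (hint 0)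
  obtain ⟨k', hk'⟩ := sum_isInt (Finset.Iic (m 1) \ D) (hint 1)
  refine ⟨k + k' + b * (A.card * D.card), ?_⟩
  rw [h, boxCut, cut, hk, hk']
  push_cast
  ring

lemma worstCaseTensor_two_isInt (hf : ∀ p, IsNonincreasing (f p))
    (hint : ∀ p i, ∃ k : ℤ, f p i = k) (hB : B = ∞ ∨ ∃ k : ℕ, B = k) (x : Idx n) :
    ∃ k : ℤ, worstCaseTensor f B x = k := by
  obtain rfl | ⟨k, rfl⟩ := hB
  · obtain ⟨k, hk⟩ := exists_nat_bound f
    rw [worstCaseTensor_top_eq one_le_two k hk]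
    exact worstCaseTensor_isInt_of_finite hf hint k x
  · exact worstCaseTensor_isInt_of_finite hf hint k x

end

/-! ### Bounds on the value tensor -/

section
variable {d : ℕ} {n : Fin d → ℕ} {f : Vectors n} {B : ℝ≥0∞} {M : Tensor n}

lemma boxSum_le_cumulative (hM : M ∈ consistentNonneg f B) (m : Idx n) (p : Fin d) :
    boxSum M m ≤ cumulative f p (m p) := by
  refine le_trans ?_ (Finset.sum_le_sum fun j _ => hM.2.1 p j)
  unfold marginal
  rw [Finset.sum_comm, boxSum_eq_sum_ite]
  refine Finset.sum_le_sum fun x _ => ?_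
  have := hM.1 x
  by_cases hx : ∀ q, x q ≤ m q
  · simp [hx]
  · rw [if_neg hx]
    exact Finset.sum_nonneg fun j _ => by split_ifs <;> simp [this]

lemma valueTensor_le_cumulative (hd : 1 ≤ d) (hf : ∀ p, IsNonincreasing (f p)) (m : Idx n)
    (p : Fin d) : valueTensor f B m ≤ cumulative f p (m p) := by
  obtain ⟨M, hM, h⟩ := exists_boxSum_eq (B := B) hd hf m
  exact h ▸ boxSum_le_cumulative hM m p

lemma valueTensor_zero_le (hd : 1 ≤ d) (hf : ∀ p, IsNonincreasing (f p)) {b : ℝ≥0} {m : Idx n}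
    (hm : ∀ p, (m p).val = 0) : valueTensor f b m ≤ b := by
  obtain ⟨M, hM, h⟩ := exists_boxSum_eq (B := b) hd hf m
  have e : Finset.Iic m = {m} := by
    ext x
    simp only [Finset.mem_Iic, Finset.mem_singleton]
    refine ⟨fun hx => funext fun p => Fin.ext ?_, fun hx => hx.le⟩
    have := Fin.le_def.1 (hx p)
    rw [hm p] at this ⊢
    omega
  rw [← h, boxSum, e, Finset.sum_singleton]
  exact coe_le_coe_iff.1 (hM.2.2 m)

/-- A constant tensor on a box bounds the value tensor from below. -/
lemma const_mul_le_valueTensor (hd : 1 ≤ d) (hf : ∀ p, IsNonincreasing (f p)) {b : ℝ≥0} {c : ℝ}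
    (hc : 0 ≤ c) (hcb : c ≤ b) (m : Idx n)
    (h : ∀ p, ∀ i ≤ m p, c * ∏ q, ((m q).val + 1 : ℝ) ≤ ((m p).val + 1) * f p i) :
    c * ∏ q, ((m q).val + 1 : ℝ) ≤ valueTensor f b m := by
  let M : Tensor n := fun x => if ∀ p, x p ≤ m p then c else 0
  have hM : M ∈ consistentNonneg f b := by
    refine ⟨fun x => ?_, fun p i => ?_, fun x => coe_le_coe_iff.2 ?_⟩
    · simp only [M]; split_ifs <;> simp [hc]
    · by_cases hi : i ≤ m p
      · have hpos : (0 : ℝ) < (m p).val + 1 := by positivity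
        refine le_of_mul_le_mul_left (le_trans (le_of_eq ?_) (h p i hi)) hpos
        have e1 : marginal M p i = ∑ x ∈ Fintype.piFinset
            (Function.update (fun q => Finset.Iic (m q)) p {i}), c := by
          have : Fintype.piFinset (Function.update (fun q => Finset.Iic (m q)) p {i}) =
              Finset.univ.filter fun x : Idx n => x p = i ∧ ∀ q, x q ≤ m q := by
            ext x
            simp only [Fintype.mem_piFinset, Finset.mem_filter, Finset.mem_univ, true_and]
            refine ⟨fun hx => ?_, fun hx q => ?_⟩
            · have hxp : x p = i := by simpa using hx p
              refine ⟨hxp, fun q => ?_⟩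
              by_cases hq : q = p
              · subst hq; rwa [hxp]
              · simpa [hq] using hx q
            · by_cases hq : q = p
              · subst hq; simp [hx.1]
              · simpa [hq] using hx.2 q
          rw [this, Finset.sum_filter, marginal]
          exact Finset.sum_congr rfl fun x _ => by by_cases hx : x p = i <;> simp [hx, M]
        rw [e1, Finset.sum_const, nsmul_eq_mul, Fintype.card_piFinset,
          ← Finset.mul_prod_erase _ _ (Finset.mem_univ p),
          ← Finset.mul_prod_erase _ (fun q => ((m q).val + 1 : ℝ)) (Finset.mem_univ p)]
        have e2 : ∏ q ∈ Finset.univ.erase p,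
            (Function.update (fun q => Finset.Iic (m q)) p {i} q).card =
            ∏ q ∈ Finset.univ.erase p, ((m q).val + 1) :=
          Finset.prod_congr rfl fun q hq => by
            rw [Function.update_of_ne (Finset.ne_of_mem_erase hq), Fin.card_Iic]
        rw [e2, Function.update_self, Finset.card_singleton]
        push_cast
        ring
      · have : marginal M p i = 0 := Finset.sum_eq_zero fun x _ => by
          by_cases hx : x p = i
          · have : ¬ ∀ q, x q ≤ m q := fun h => hi (hx ▸ h p)
            simp only [M, this, if_false, ite_self]
          · simp [hx]
        rw [this]
        exact (hf p).1 i
    · simp only [M]; split_ifs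
      · exact hcb
      · exact b.2
  refine le_of_eq_of_le ?_ (boxSum_le_valueTensor hd hf hM m)
  have e1 : Finset.Iic m = Fintype.piFinset fun q => Finset.Iic (m q) := by
    ext x; simp [Pi.le_def]
  have e2 : boxSum M m = ∑ x ∈ Finset.Iic m, c := Finset.sum_congr rfl fun x hx => by
    have : ∀ p, x p ≤ m p := Finset.mem_Iic.1 hx
    simp [M, this]
  rw [e2, e1, Finset.sum_const, nsmul_eq_mul, Fintype.card_piFinset]
  simp [Fin.card_Iic, mul_comm]

lemma cumulative_of_const {p : Fin d} {t : ℝ} (h : ∀ i, f p i = t) (r : Fin (n p)) :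
    cumulative f p r = (r.val + 1) * t := by
  simp [cumulative, h, Fin.card_Iic]

lemma isNonincreasing_const {k : ℕ} {t : ℝ} (ht : 0 ≤ t) :
    IsNonincreasing fun _ : Fin k => t :=
  ⟨fun _ => ht, fun _ _ _ => le_rfl⟩

lemma foldr_delta_of_zero (T : Tensor n) (l : List (Fin d)) (x : Idx n)
    (h : ∀ p ∈ l, (x p).val = 0) : l.foldr delta T x = T x := by
  induction l with
  | nil => rfl
  | cons p l ih =>
    rw [List.foldr_cons, delta, if_pos (h p (by simp)), sub_zero]
    exact ih fun q hq => h q (by simp [hq])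

end

/-! ### Tensors with two proper dimensions -/

/-- The shape `k × k × 1 × ⋯ × 1`. -/
def planeShape (e k : ℕ) (p : Fin (e + 2)) : ℕ := if p = 0 then k else if p = 1 then k else 1

/-- The index tuple `(i, j, 0, …, 0)`. -/
def planeIdx (e : ℕ) {k : ℕ} (i j : Fin k) : Idx (planeShape e k) := fun p =>
  ⟨if p = 0 then i.val else if p = 1 then j.val else 0, by
    unfold planeShape; split_ifs <;> omega⟩

section
variable {e k : ℕ}

lemma planeIdx_zero (i j : Fin k) : (planeIdx e i j 0).val = i := by simp [planeIdx]

lemma planeIdx_one (i j : Fin k) : (planeIdx e i j 1).val = j := by simp [planeIdx]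

lemma planeIdx_of_ne (i j : Fin k) {p : Fin (e + 2)} (h0 : p ≠ 0) (h1 : p ≠ 1) :
    (planeIdx e i j p).val = 0 := by simp [planeIdx, h0, h1]

lemma planeShape_pos (hk : 0 < k) (p : Fin (e + 2)) : 0 < planeShape e k p := by
  unfold planeShape; split_ifs <;> omega

lemma prod_planeIdx (i j : Fin k) :
    ∏ q, ((planeIdx e i j q).val + 1 : ℝ) = (i.val + 1) * (j.val + 1) := by
  rw [Fin.prod_univ_succ, Fin.prod_univ_succ, planeIdx_zero, Fin.succ_zero_eq_one,
    planeIdx_one, Finset.prod_eq_one, mul_one]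
  intro q _
  rw [planeIdx_of_ne _ _ (Fin.succ_ne_zero _) fun h =>
    Fin.succ_ne_zero q (Fin.succ_injective _ h)]
  simp

lemma delta_planeIdx_zero (T : Tensor (planeShape e k)) (i' i j : Fin k)
    (h : i'.val + 1 = i.val) :
    delta 0 T (planeIdx e i j) = T (planeIdx e i j) - T (planeIdx e i' j) := by
  rw [delta, if_neg (by rw [planeIdx_zero]; omega)]
  congr 2
  ext p
  by_cases hp : p = 0
  · subst hp
    simp [planeIdx_zero]
    omega
  · simp [hp, planeIdx]

lemma delta_planeIdx_one (T : Tensor (planeShape e k)) (i j' j : Fin k)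
    (h : j'.val + 1 = j.val) :
    delta 1 T (planeIdx e i j) = T (planeIdx e i j) - T (planeIdx e i j') := by
  rw [delta, if_neg (by rw [planeIdx_one]; omega)]
  congr 2
  ext p
  by_cases hp : p = 1
  · subst hp
    simp [planeIdx_one]
    omega
  · simp [hp, planeIdx]

lemma worstCaseTensor_planeIdx (f : Vectors (planeShape e k)) (B : ℝ≥0∞) {i' i j' j : Fin k}
    (hi : i'.val + 1 = i.val) (hj : j'.val + 1 = j.val) :
    worstCaseTensor f B (planeIdx e i j) =
      valueTensor f B (planeIdx e i j) - valueTensor f B (planeIdx e i j') -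
        (valueTensor f B (planeIdx e i' j) - valueTensor f B (planeIdx e i' j')) := by
  have hl : ∀ u v : Fin k, (((List.finRange e).map Fin.succ).map Fin.succ).foldr delta
      (valueTensor f B) (planeIdx e u v) = valueTensor f B (planeIdx e u v) := fun u v => by
    refine foldr_delta_of_zero _ _ _ fun p hp => ?_
    simp only [List.map_map, List.mem_map, Function.comp] at hp
    obtain ⟨q, -, rfl⟩ := hp
    exact planeIdx_of_ne _ _ (Fin.succ_ne_zero _)
      fun h => Fin.succ_ne_zero q (Fin.succ_injective _ h)
  rw [worstCaseTensor, List.finRange_succ, List.finRange_succ, List.map_cons, List.foldr_cons,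
    List.foldr_cons, Fin.succ_zero_eq_one, delta_planeIdx_zero _ i' i j hi,
    delta_planeIdx_one _ i j' j hj, delta_planeIdx_one _ i' j' j hj, hl, hl, hl, hl]

end

/-- With three or more dimensions, negative entries occur: a bound on the total sum, which a third
dimension imposes, destroys supermodularity of the value tensor in the first two dimensions. -/
lemma exists_worstCaseTensor_neg (d : ℕ) (hd : 3 ≤ d) (b : ℝ≥0) (hb : 0 < b) :
    ∃ (n : Fin d → ℕ) (f : Vectors n), (∀ p, 0 < n p) ∧ (∀ p, IsNonincreasing (f p)) ∧
      ∃ x, worstCaseTensor f (b : ℝ≥0∞) x < 0 := by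
  obtain ⟨e, rfl⟩ : ∃ e, d = e + 1 + 2 := ⟨d - 3, by omega⟩
  have hb' : (0 : ℝ) < b := hb
  let f : Vectors (planeShape (e + 1) 2) := fun _ _ => 2 * b
  have hf : ∀ p, IsNonincreasing (f p) := fun p => isNonincreasing_const (by positivity)
  have hd1 : 1 ≤ e + 1 + 2 := by omega
  refine ⟨planeShape (e + 1) 2, f, planeShape_pos two_pos, hf, planeIdx (e + 1) 1 1, ?_⟩
  rw [worstCaseTensor_planeIdx f b (i' := 0) (j' := 0) rfl rfl]
  have h11 := valueTensor_le_cumulative (B := b) hd1 hf (planeIdx (e + 1) 1 1)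
    (Fin.succ (Fin.succ 0))
  rw [cumulative_of_const (t := 2 * b) (fun _ => rfl), planeIdx_of_ne _ _ (Fin.succ_ne_zero _)
    fun h => Fin.succ_ne_zero 0 (Fin.succ_injective _ h)] at h11
  have h00 := valueTensor_zero_le (b := b) hd1 hf (m := planeIdx (e + 1) 0 0)
    fun p => by simp [planeIdx]
  have hlow : ∀ i j : Fin 2, (i.val + 1 : ℝ) * (j.val + 1) = 2 →
      b * 2 ≤ valueTensor f b (planeIdx (e + 1) i j) := fun i j hij => by
    have := const_mul_le_valueTensor (b := b) (c := b) hd1 hf hb'.le le_rfl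
      (planeIdx (e + 1) i j) fun p i' _ => by
        rw [prod_planeIdx, hij]
        have : (0 : ℝ) ≤ (planeIdx (e + 1) i j p).val := by positivity
        have := mul_nonneg this hb'.le
        simp only [f]
        linarith
    rwa [prod_planeIdx, hij] at this
  have h01 := hlow 0 1 (by norm_num)
  have h10 := hlow 1 0 (by norm_num)
  push_cast at h11
  linarith

/-- The bound `B` may be exceeded by the entries of the worst-case tensor: with all degrees `2 B`
in two dimensions of size three, `V` is `4 B` on the boxes `2 × 2`, `2 × 3` and `3 × 2`, but `6 B`
on the box `3 × 3`. -/
lemma exists_lt_worstCaseTensor (d : ℕ) (hd : 2 ≤ d) (b : ℝ≥0) (hb : 0 < b) :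
    ∃ (n : Fin d → ℕ) (f : Vectors n), (∀ p, 0 < n p) ∧ (∀ p, IsNonincreasing (f p)) ∧
      ∃ x, (b : ℝ) < worstCaseTensor f (b : ℝ≥0∞) x := by
  obtain ⟨e, rfl⟩ : ∃ e, d = e + 2 := ⟨d - 2, by omega⟩
  have hb' : (0 : ℝ) < b := hb
  let f : Vectors (planeShape e 3) := fun p _ => if p = 0 then 2 * b else if p = 1 then 2 * b
    else 6 * b
  have hf : ∀ p, IsNonincreasing (f p) := fun p =>
    isNonincreasing_const (by split_ifs <;> positivity)
  have hd1 : 1 ≤ e + 2 := by omega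
  refine ⟨planeShape e 3, f, planeShape_pos three_pos, hf, planeIdx e 2 2, ?_⟩
  rw [worstCaseTensor_planeIdx f b (i' := 1) (j' := 1) rfl rfl]
  have h12 := valueTensor_le_cumulative (B := b) hd1 hf (planeIdx e 1 2) 0
  rw [cumulative_of_const (t := 2 * b) (fun _ => by simp [f]), planeIdx_zero] at h12
  have h21 := valueTensor_le_cumulative (B := b) hd1 hf (planeIdx e 2 1) 1
  rw [cumulative_of_const (t := 2 * b) (fun _ => by simp [f]), planeIdx_one] at h21
  have hlow : ∀ (i : Fin 3) (c : ℝ), 0 ≤ c → c ≤ b → c * (i.val + 1) = 2 * b →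
      2 * b * (i.val + 1) ≤ valueTensor f b (planeIdx e i i) := fun i c hc hcb hci => by
    have hi : (0 : ℝ) ≤ i.val := by positivity
    have hi2 : (i.val : ℝ) ≤ 2 := by exact_mod_cast Nat.le_of_lt_succ i.isLt
    have h := const_mul_le_valueTensor (b := b) hd1 hf hc hcb (planeIdx e i i) fun p i' _ => by
      rw [prod_planeIdx, ← mul_assoc, hci]
      by_cases h0 : p = 0
      · subst h0
        simp only [planeIdx_zero, f, if_true]
        linarith
      · by_cases h1 : p = 1
        · subst h1
          simp only [planeIdx_one, f, if_true, ite_self]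
          linarith
        · simp only [planeIdx_of_ne _ _ h0 h1, f, h0, h1, if_false]
          have := mul_le_mul_of_nonneg_left hi2 hb'.le
          push_cast
          linarith
    rwa [prod_planeIdx, ← mul_assoc, hci] at h
  have h11 := hlow 1 b hb'.le le_rfl (by norm_num; ring)
  have h22 := hlow 2 (2 * b / 3) (by positivity) (by linarith) (by norm_num)
  norm_num at h12 h21 h11 h22
  linarith

/-! ### Phases of the greedy machine -/

section
variable {d : ℕ} {n : Fin d → ℕ} {τ : State d → Bool}

lemma iterate_init (S : State d) (hS : S.loc = Loc.init 0) (hs : S.s = fun _ => 0) :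
    ∀ j ≤ d, (step n τ)^[j] S = { S with loc := Loc.init j } := by
  intro j
  induction j with
  | zero => intro _; rw [← hS]; rfl
  | succ j ih =>
    intro hj
    rw [Function.iterate_succ_apply', ih (by omega)]
    have hj' : j < d := by omega
    have : Function.update S.s ⟨j, hj'⟩ 0 = S.s := by
      rw [hs]; exact Function.update_eq_self (⟨j, hj'⟩ : Fin d) fun _ => 0
    simp [step, hj', this]

lemma iterate_init_done (S : State d) (hS : S.loc = Loc.init 0) (hs : S.s = fun _ => 0) :
    (step n τ)^[d + 1] S = { S with loc := Loc.test 0 } := by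
  rw [Function.iterate_succ_apply', iterate_init S hS hs d le_rfl]
  simp [step]

lemma iterate_test (S : State d) (hS : S.loc = Loc.test 0) :
    ∀ j ≤ d, (∀ p : Fin d, p.val < j → S.s p < n p) →
      (step n τ)^[j] S = { S with loc := Loc.test j } := by
  intro j
  induction j with
  | zero => intro _ _; rw [← hS]; rfl
  | succ j ih =>
    intro hj h
    have hj' : j < d := by omega
    rw [Function.iterate_succ_apply', ih (by omega) fun p hp => h p (by omega)]
    simp [step, hj', h ⟨j, hj'⟩ (Nat.lt_succ_self j)]

lemma iterate_test_pass (S : State d) (hS : S.loc = Loc.test 0) (h : ∀ p, S.s p < n p) :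
    (step n τ)^[d + 1] S = { S with loc := Loc.scan 0 } := by
  rw [Function.iterate_succ_apply', iterate_test S hS d le_rfl fun p _ => h p]
  simp [step]

lemma iterate_test_halt (S : State d) (hS : S.loc = Loc.test 0) (h : ∃ p, ¬ S.s p < n p) :
    ∃ j ≤ d + 1, (step n τ)^[j] S = { S with loc := Loc.halt } := by
  obtain ⟨p, hp, hmin⟩ := WellFounded.has_min (wellFounded_lt (α := Fin d))
    {p | ¬ S.s p < n p} h
  refine ⟨p.val + 1, by omega, ?_⟩
  rw [Function.iterate_succ_apply', iterate_test S hS p.val p.isLt.le fun q hq => by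
    by_contra h2
    exact hmin q h2 (Fin.lt_def.2 hq)]
  simp only [Set.mem_ofPred_eq] at hp
  simp [step, hp]

/-- After the first `j` transitions of the scan, `pmin` is a dimension of minimal residual degree
among the first `j` ones, whatever the tie-breaking. -/
lemma iterate_scan (S : State d) (hS : S.loc = Loc.scan 0) :
    ∀ j ≤ d, ∃ pm dm, (step n τ)^[j] S = { S with loc := Loc.scan j, pmin := pm, dmin := dm } ∧
      (0 < j → ∃ q : Fin d, q.val = pm ∧ dm = S.r q (S.s q) ∧
        ∀ p : Fin d, p.val < j → dm ≤ S.r p (S.s p)) := by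
  intro j
  induction j with
  | zero => intro _; exact ⟨S.pmin, S.dmin, by rw [← hS]; rfl, fun h => absurd h (lt_irrefl _)⟩
  | succ j ih =>
    intro hj
    have hj' : j < d := by omega
    obtain ⟨pm, dm, e, h⟩ := ih (by omega)
    rw [Function.iterate_succ_apply', e]
    by_cases hc : j = 0 ∨ S.r ⟨j, hj'⟩ (S.s ⟨j, hj'⟩) < dm ∨
        (S.r ⟨j, hj'⟩ (S.s ⟨j, hj'⟩) = dm ∧
          τ { S with loc := Loc.scan j, pmin := pm, dmin := dm } = true)
    · refine ⟨j, S.r ⟨j, hj'⟩ (S.s ⟨j, hj'⟩), ?_, fun _ => ⟨⟨j, hj'⟩, rfl, rfl, fun p hp => ?_⟩⟩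
      · simp only [step, hj', dif_pos]
        rw [if_pos hc]
      · rcases Nat.lt_succ_iff_lt_or_eq.1 hp with h1 | h1
        · obtain ⟨q, -, -, h3⟩ := h (by omega)
          have := h3 p h1
          rcases hc with h4 | h4 | h4
          · omega
          · linarith
          · linarith [h4.1]
        · have : p = ⟨j, hj'⟩ := Fin.ext h1
          rw [this]
    · refine ⟨pm, dm, ?_, fun _ => ?_⟩
      · simp only [step, hj', dif_pos]
        rw [if_neg hc]
      · push Not at hc
        obtain ⟨q, h1, h2, h3⟩ := h (by omega)
        refine ⟨q, h1, h2, fun p hp => ?_⟩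
        rcases Nat.lt_succ_iff_lt_or_eq.1 hp with h4 | h4
        · exact h3 p h4
        · have : p = ⟨j, hj'⟩ := Fin.ext h4
          rw [this]; exact hc.2.1

lemma iterate_scan_done (hd : 1 ≤ d) (S : State d) (hS : S.loc = Loc.scan 0) :
    ∃ q : Fin d, (∀ p, S.r q (S.s q) ≤ S.r p (S.s p)) ∧
      (step n τ)^[d + 1] S =
        { S with loc := Loc.addr 0, pmin := q.val, dmin := S.r q (S.s q) } := by
  obtain ⟨pm, dm, e, h⟩ := iterate_scan (n := n) (τ := τ) S hS d le_rfl
  obtain ⟨q, rfl, rfl, h3⟩ := h hd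
  refine ⟨q, fun p => h3 p p.isLt, ?_⟩
  rw [Function.iterate_succ_apply', e]
  simp [step]

lemma iterate_addr (S : State d) (hS : S.loc = Loc.addr 0) :
    ∀ j ≤ d, ∃ ix, (step n τ)^[j] S =
        { S with loc := Loc.addr j, idx := Function.update S.idx S.len ix } ∧
      ∀ p : Fin d, p.val < j → ix p = S.s p := by
  intro j
  induction j with
  | zero =>
    intro _
    exact ⟨S.idx S.len, by rw [← hS, Function.update_eq_self]; rfl, fun p hp => by omega⟩
  | succ j ih =>
    intro hj
    have hj' : j < d := by omega
    obtain ⟨ix, e, h⟩ := ih (by omega)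
    rw [Function.iterate_succ_apply', e]
    refine ⟨Function.update ix ⟨j, hj'⟩ (S.s ⟨j, hj'⟩), ?_, fun p hp => ?_⟩
    · simp [step, hj']
    · by_cases hpj : p = ⟨j, hj'⟩
      · subst hpj; simp
      · rw [Function.update_of_ne hpj]
        exact h p (by have : p.val ≠ j := fun e => hpj (Fin.ext e)
                      omega)

lemma iterate_addr_done (S : State d) (hS : S.loc = Loc.addr 0) :
    (step n τ)^[d + 1] S =
      { S with loc := Loc.write, idx := Function.update S.idx S.len S.s } := by
  obtain ⟨ix, e, h⟩ := iterate_addr (n := n) (τ := τ) S hS d le_rfl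
  obtain rfl : ix = S.s := funext fun p => h p p.isLt
  rw [Function.iterate_succ_apply', e]
  simp [step]

lemma iterate_sub (S : State d) (hS : S.loc = Loc.sub 0) :
    ∀ j ≤ d, (step n τ)^[j] S = { S with
      loc := Loc.sub j
      r := fun p => if p.val < j then Function.update (S.r p) (S.s p) (S.r p (S.s p) - S.dmin)
        else S.r p } := by
  intro j
  induction j with
  | zero => intro _; simp [← hS]
  | succ j ih =>
    intro hj
    have hj' : j < d := by omega
    rw [Function.iterate_succ_apply', ih (by omega)]
    simp only [step, hj', dif_pos, lt_irrefl, if_false]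
    congr 1
    ext p : 1
    by_cases hpj : p = ⟨j, hj'⟩
    · subst hpj; simp
    · have h1 : p.val ≠ j := fun e => hpj (Fin.ext e)
      rw [Function.update_of_ne hpj]
      by_cases h2 : p.val < j
      · rw [if_pos h2, if_pos (by omega)]
      · rw [if_neg h2, if_neg (by omega)]

lemma iterate_sub_done (S : State d) (hS : S.loc = Loc.sub 0) :
    (step n τ)^[d + 1] S = { S with
      loc := Loc.incr
      r := fun p => Function.update (S.r p) (S.s p) (S.r p (S.s p) - S.dmin) } := by
  rw [Function.iterate_succ_apply', iterate_sub S hS d le_rfl]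
  simp [step]

/-- The effect of one pass through the loop: some dimension `q` of minimal residual degree is
chosen, this minimum is output at the current position and subtracted, and the position advances
along `q`. -/
lemma iterate_pass (hd : 1 ≤ d) (S : State d) (hS : S.loc = Loc.test 0) (h : ∀ p, S.s p < n p) :
    ∃ q : Fin d, (∀ p, S.r q (S.s q) ≤ S.r p (S.s p)) ∧
      (step n τ)^[4 * d + 6] S =
        { loc := Loc.test 0
          s := fun p => if p = q then S.s p + 1 else S.s p
          r := fun p => Function.update (S.r p) (S.s p) (S.r p (S.s p) - S.r q (S.s q))
          pmin := q.val
          dmin := S.r q (S.s q)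
          idx := Function.update S.idx S.len S.s
          val := Function.update S.val S.len (S.r q (S.s q))
          len := S.len + 1 } := by
  have e : 4 * d + 6 = 1 + ((d + 1) + (1 + ((d + 1) + ((d + 1) + (d + 1))))) := by ring
  obtain ⟨q, hq, hscan⟩ := iterate_scan_done (n := n) (τ := τ) hd { S with loc := Loc.scan 0 } rfl
  refine ⟨q, hq, ?_⟩
  rw [e, Function.iterate_add_apply _ 1, Function.iterate_add_apply _ (d + 1) (1 + _),
    Function.iterate_add_apply _ 1, Function.iterate_add_apply _ (d + 1) (d + 1 + _),
    Function.iterate_add_apply _ (d + 1) (d + 1), iterate_test_pass S hS h, hscan,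
    iterate_addr_done { S with loc := Loc.addr 0, pmin := q.val, dmin := S.r q (S.s q) } rfl]
  have hw : ∀ S : State d, S.loc = Loc.write → (step n τ)^[1] S =
      { S with val := Function.update S.val S.len S.dmin, len := S.len + 1, loc := Loc.sub 0 } :=
    fun S hS => by simp [step, hS]
  rw [hw { S with
    loc := Loc.write
    pmin := q.val
    dmin := S.r q (S.s q)
    idx := Function.update S.idx S.len S.s } rfl, iterate_sub_done _ rfl]
  simp [step, Fin.ext_iff]

end

/-! ### Correctness of the greedy algorithm -/

section
variable {d : ℕ} {n : Fin d → ℕ} {f : Vectors n} {τ : State d → Bool}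

/-- The degree of a rank, continued by `0`. -/
def degree (f : Vectors n) (p : Fin d) (k : ℕ) : ℝ := if h : k < n p then f p ⟨k, h⟩ else 0

/-- The sum of the `k` largest degrees. -/
def prefixSum (f : Vectors n) (p : Fin d) (k : ℕ) : ℝ := ∑ j ∈ Finset.range k, degree f p j

lemma degree_nonneg (hf : ∀ p, IsNonincreasing (f p)) (p : Fin d) (k : ℕ) : 0 ≤ degree f p k := by
  unfold degree
  split_ifs
  · exact (hf p).1 _
  · exact le_rfl

lemma prefixSum_succ (p : Fin d) (k : ℕ) :
    prefixSum f p (k + 1) = prefixSum f p k + degree f p k := Finset.sum_range_succ _ _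

lemma prefixSum_mono (hf : ∀ p, IsNonincreasing (f p)) (p : Fin d) : Monotone (prefixSum f p) :=
  monotone_nat_of_le_succ fun k => by
    rw [prefixSum_succ]; linarith [degree_nonneg hf p k]

lemma prefixSum_eq_cumulative (p : Fin d) (r : Fin (n p)) :
    prefixSum f p (r.val + 1) = cumulative f p r := by
  unfold prefixSum cumulative
  symm
  refine Finset.sum_bij (fun i _ => i.val) ?_ ?_ ?_ ?_
  · intro i hi
    have := Fin.le_def.1 (Finset.mem_Iic.1 hi)
    exact Finset.mem_range.2 (by omega)
  · intro i _ j _ h; exact Fin.ext h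
  · intro k hk
    have := Finset.mem_range.1 hk
    have := r.isLt
    exact ⟨⟨k, by omega⟩, Finset.mem_Iic.2 (Fin.le_def.2 (by simp; omega)), rfl⟩
  · intro i _
    simp [degree]

/-- The sum of the first `len` output values at positions in the box below `m`. -/
def outputBox (S : State d) (m : Fin d → ℕ) : ℝ :=
  ∑ k ∈ Finset.range S.len, if ∀ p, S.idx k p ≤ m p then S.val k else 0

/-- The loop invariant. The total `t` of the values output so far lies between the prefix sums
of the degrees before and after the current position, in every dimension; hence the residual degree
at the current position is the difference to the upper one, and the output has the box sums
`min t (min_p F_p(m_p))`. -/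
structure Invariant (f : Vectors n) (S : State d) (t : ℝ) : Prop where
  pos_le : ∀ p, S.s p ≤ n p
  len_eq : S.len = ∑ p, S.s p
  le_total : ∀ p, prefixSum f p (S.s p) ≤ t
  total_le : ∀ p, t ≤ prefixSum f p (S.s p + 1)
  residual : ∀ p, S.r p (S.s p) = prefixSum f p (S.s p + 1) - t
  untouched : ∀ p k, S.s p < k → S.r p k = degree f p k
  val_nonneg : ∀ k < S.len, 0 ≤ S.val k
  idx_lt : ∀ k < S.len, ∀ p, S.idx k p < n p
  box_le_total : ∀ m, outputBox S m ≤ t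
  box_le : ∀ m p, outputBox S m ≤ prefixSum f p (m p + 1)
  box_eq : ∀ m, outputBox S m = t ∨ ∃ p, outputBox S m = prefixSum f p (m p + 1)

lemma Invariant.of_eq {S S' : State d} {t : ℝ} (h : Invariant f S t)
    (hS : S' = { S with loc := S'.loc }) : Invariant f S' t := by
  rw [hS]
  exact ⟨h.1, h.2, h.3, h.4, h.5, h.6, h.7, h.8, h.9, h.10, h.11⟩

lemma invariant_start (hf : ∀ p, IsNonincreasing (f p)) : Invariant f (start f) 0 where
  pos_le p := Nat.zero_le _
  len_eq := by simp [start]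
  le_total p := by simp [start, prefixSum]
  total_le p := by simp [start, prefixSum, degree_nonneg hf]
  residual p := by simp [start, prefixSum, degree]
  untouched p k _ := rfl
  val_nonneg k hk := absurd hk (Nat.not_lt_zero k)
  idx_lt k hk := absurd hk (Nat.not_lt_zero k)
  box_le_total m := by simp [outputBox, start]
  box_le m p := by
    have e : outputBox (start f) m = 0 := by simp [outputBox, start]
    rw [e]
    exact Finset.sum_nonneg fun j _ => degree_nonneg hf p j
  box_eq m := Or.inl (by simp [outputBox, start])

lemma Invariant.pass (hf : ∀ p, IsNonincreasing (f p)) {S : State d} {t : ℝ}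
    (h : Invariant f S t) (hs : ∀ p, S.s p < n p) {q : Fin d}
    (hq : ∀ p, S.r q (S.s q) ≤ S.r p (S.s p)) :
    Invariant f
        { loc := Loc.test 0
          s := fun p => if p = q then S.s p + 1 else S.s p
          r := fun p => Function.update (S.r p) (S.s p) (S.r p (S.s p) - S.r q (S.s q))
          pmin := q.val
          dmin := S.r q (S.s q)
          idx := Function.update S.idx S.len S.s
          val := Function.update S.val S.len (S.r q (S.s q))
          len := S.len + 1 } (prefixSum f q (S.s q + 1)) := by
  have hmin : ∀ p, prefixSum f q (S.s q + 1) ≤ prefixSum f p (S.s p + 1) := fun p => by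
    have := hq p
    rw [h.residual, h.residual] at this
    linarith
  have htt := h.total_le q
  have hbox : ∀ m : Fin d → ℕ, outputBox
        { loc := Loc.test 0
          s := fun p => if p = q then S.s p + 1 else S.s p
          r := fun p => Function.update (S.r p) (S.s p) (S.r p (S.s p) - S.r q (S.s q))
          pmin := q.val
          dmin := S.r q (S.s q)
          idx := Function.update S.idx S.len S.s
          val := Function.update S.val S.len (S.r q (S.s q))
          len := S.len + 1 } m =
      outputBox S m + if ∀ p, S.s p ≤ m p then S.r q (S.s q) else 0 := fun m => by
    unfold outputBox
    rw [Finset.sum_range_succ]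
    simp only [Function.update_self]
    congr 1
    refine Finset.sum_congr rfl fun k hk => ?_
    have hk : k ≠ S.len := (Finset.mem_range.1 hk).ne
    rw [Function.update_of_ne hk, Function.update_of_ne hk]
  -- inside the box everything output so far counts, and outside the box sum is already final
  have hin : ∀ m : Fin d → ℕ, (∀ p, S.s p ≤ m p) → outputBox S m = t := fun m hm => by
    rcases h.box_eq m with e | ⟨p, e⟩
    · exact e
    · refine le_antisymm (h.box_le_total m) ?_
      rw [e]
      exact (h.total_le p).trans (prefixSum_mono hf p (Nat.succ_le_succ (hm p)))
  have hout : ∀ m : Fin d → ℕ, (¬ ∀ p, S.s p ≤ m p) →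
      ∃ p, outputBox S m = prefixSum f p (m p + 1) := fun m hm => by
    obtain ⟨p, hp⟩ := not_forall.1 hm
    have h1 : prefixSum f p (m p + 1) ≤ t :=
      (prefixSum_mono hf p (by omega : m p + 1 ≤ S.s p)).trans (h.le_total p)
    rcases h.box_eq m with e | e
    · exact ⟨p, le_antisymm (h.box_le m p) (by linarith)⟩
    · exact e
  have hnew : ∀ m : Fin d → ℕ, (∀ p, S.s p ≤ m p) →
      outputBox S m + (if ∀ p, S.s p ≤ m p then S.r q (S.s q) else 0) =
        prefixSum f q (S.s q + 1) := fun m hm => by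
    rw [if_pos hm, hin m hm, h.residual]; ring
  refine ⟨fun p => ?_, ?_, fun p => ?_, fun p => ?_, fun p => ?_, fun p k hk => ?_,
    fun k hk => ?_, fun k hk p => ?_, fun m => ?_, fun m p => ?_, fun m => ?_⟩
  · have := hs p
    dsimp only
    split_ifs <;> omega
  · have e : ∀ p, (if p = q then S.s p + 1 else S.s p) = S.s p + if p = q then 1 else 0 :=
      fun p => by split_ifs <;> rfl
    simp only [e, Finset.sum_add_distrib, Finset.sum_ite_eq', Finset.mem_univ, if_true, h.len_eq]
  · dsimp only
    split_ifs with hp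
    · rw [hp]
    · exact (h.le_total p).trans htt
  · dsimp only
    split_ifs with hp
    · rw [hp]; exact prefixSum_mono hf q (Nat.le_succ _)
    · exact hmin p
  · dsimp only
    split_ifs with hp
    · subst hp
      rw [Function.update_of_ne (Nat.succ_ne_self _), h.untouched _ _ (Nat.lt_succ_self _),
        prefixSum_succ p (S.s p + 1)]
      ring
    · rw [Function.update_self, h.residual, h.residual]; ring
  · dsimp only at hk ⊢
    have hk' : S.s p < k := by split_ifs at hk <;> omega
    rw [Function.update_of_ne hk'.ne', h.untouched p k hk']
  · dsimp only at hk ⊢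
    by_cases hkl : k = S.len
    · rw [hkl, Function.update_self, h.residual]
      linarith
    · rw [Function.update_of_ne hkl]
      exact h.val_nonneg k (by omega)
  · dsimp only at hk ⊢
    by_cases hkl : k = S.len
    · rw [hkl, Function.update_self]; exact hs p
    · rw [Function.update_of_ne hkl]
      exact h.idx_lt k (by omega) p
  · rw [hbox]
    by_cases hm : ∀ p, S.s p ≤ m p
    · exact (hnew m hm).le
    · rw [if_neg hm, add_zero]; exact (h.box_le_total m).trans htt
  · rw [hbox]
    by_cases hm : ∀ p, S.s p ≤ m p
    · rw [hnew m hm]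
      exact (hmin p).trans (prefixSum_mono hf p (Nat.succ_le_succ (hm p)))
    · rw [if_neg hm, add_zero]; exact h.box_le m p
  · rw [hbox]
    by_cases hm : ∀ p, S.s p ≤ m p
    · exact Or.inl (hnew m hm)
    · rw [if_neg hm, add_zero]; exact Or.inr (hout m hm)

/-- From the head of the loop, the machine halts within the time for `k` passes and one more test,
if `k` bounds the number of ranks that are left. -/
lemma exists_halt (hd : 1 ≤ d) (hf : ∀ p, IsNonincreasing (f p)) (k : ℕ) :
    ∀ (S : State d) (t : ℝ), S.loc = Loc.test 0 → Invariant f S t → ∑ p, n p ≤ S.len + k →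
      ∃ N ≤ k * (4 * d + 6) + (d + 1), ∃ t', ((step n τ)^[N] S).loc = Loc.halt ∧
        Invariant f ((step n τ)^[N] S) t' ∧ ∃ p, ((step n τ)^[N] S).s p = n p := by
  induction k with
  | zero =>
    intro S t hS h hk
    have : ∃ p, ¬ S.s p < n p := by
      by_contra! hlt
      have := Finset.sum_lt_sum_of_nonempty ⟨⟨0, hd⟩, Finset.mem_univ _⟩ fun p _ => hlt p
      rw [← h.len_eq] at this
      omega
    obtain ⟨j, hj, e⟩ := iterate_test_halt (τ := τ) S hS this
    obtain ⟨p, hp⟩ := this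
    refine ⟨j, by omega, t, ?_⟩
    rw [e]
    exact ⟨rfl, h.of_eq rfl, p, le_antisymm (h.pos_le p) (not_lt.1 hp)⟩
  | succ k ih =>
    intro S t hS h hk
    by_cases hlt : ∀ p, S.s p < n p
    · obtain ⟨q, hq, e⟩ := iterate_pass (τ := τ) hd S hS hlt
      obtain ⟨N, hN, t', h'⟩ := ih _ _ rfl (h.pass hf hlt hq) (by dsimp only; omega)
      refine ⟨N + (4 * d + 6), by
        have : (k + 1) * (4 * d + 6) = k * (4 * d + 6) + (4 * d + 6) := Nat.succ_mul _ _
        omega, t', ?_⟩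
      rw [Function.iterate_add_apply, e]
      exact h'
    · obtain ⟨j, hj, e⟩ := iterate_test_halt (τ := τ) S hS (not_forall.1 hlt)
      obtain ⟨p, hp⟩ := not_forall.1 hlt
      refine ⟨j, hj.trans (Nat.le_add_left _ _), t, ?_⟩
      rw [e]
      exact ⟨rfl, h.of_eq rfl, p, le_antisymm (h.pos_le p) (not_lt.1 hp)⟩

lemma boxSum_output {S : State d} {t : ℝ} (h : Invariant f S t) (m : Idx n) :
    boxSum (S.output n) m = outputBox S fun p => (m p).val := by
  unfold boxSum State.output outputBox
  rw [Finset.sum_comm]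
  refine Finset.sum_congr rfl fun k hk => ?_
  have hlt := h.idx_lt k (Finset.mem_range.1 hk)
  have e : ∀ x : Idx n, (∀ p, S.idx k p = (x p).val) ↔ x = fun p => ⟨S.idx k p, hlt p⟩ :=
    fun x => ⟨fun hx => funext fun p => Fin.ext (hx p).symm, fun hx p => by rw [hx]⟩
  simp only [e, Finset.sum_ite_eq']
  exact if_congr Finset.mem_Iic rfl rfl

/-- When the machine halts, its output has the box sums `min_p F_p(m_p)`. -/
lemma isLeast_boxSum_output (hf : ∀ p, IsNonincreasing (f p)) {S : State d} {t : ℝ}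
    (h : Invariant f S t) {p₀ : Fin d} (hp : S.s p₀ = n p₀) (m : Idx n) :
    IsLeast (Set.range fun p => cumulative f p (m p)) (boxSum (S.output n) m) := by
  simp only [← prefixSum_eq_cumulative, boxSum_output h]
  refine ⟨?_, by rintro _ ⟨p, rfl⟩; exact h.box_le _ p⟩
  rcases h.box_eq fun p => (m p).val with e | ⟨p, e⟩
  · have h1 : prefixSum f p₀ ((m p₀).val + 1) ≤ t :=
      (prefixSum_mono hf p₀ (by rw [hp]; exact (m p₀).isLt)).trans (h.le_total p₀)
    exact ⟨p₀, le_antisymm (by dsimp only; rw [e]; exact h1) (h.box_le _ p₀)⟩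
  · exact ⟨p, e.symm⟩

lemma output_nonneg {S : State d} {t : ℝ} (h : Invariant f S t) (x : Idx n) :
    0 ≤ S.output n x :=
  Finset.sum_nonneg fun k hk => by
    have := h.val_nonneg k (Finset.mem_range.1 hk)
    split_ifs
    · exact this
    · exact le_rfl

lemma cumulative_eq_add (p : Fin d) (r : Fin (n p)) (hr : r.val ≠ 0) :
    cumulative f p r =
      cumulative f p ⟨r.val - 1, (Nat.sub_le _ _).trans_lt r.isLt⟩ + f p r := by
  have h : r.val - 1 + 1 = r.val := by omega
  rw [← prefixSum_eq_cumulative, ← prefixSum_eq_cumulative, prefixSum_succ]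
  simp [h, degree]

/-- Non-negative tensors with the box sums `min_p F_p(m_p)` are consistent with the degrees. -/
lemma mem_consistentNonneg_of_isLeast (hn : ∀ p, 0 < n p) (hf : ∀ p, IsNonincreasing (f p))
    {T : Tensor n} (h0 : ∀ x, 0 ≤ T x)
    (h : ∀ m, IsLeast (Set.range fun p => cumulative f p (m p)) (boxSum T m)) :
    T ∈ consistentNonneg f ∞ := by
  refine ⟨h0, fun p i => ?_, fun x => by simp⟩
  have key : ∀ m : Idx n, delta p (boxSum T) m ≤ f p (m p) := fun m => by
    unfold delta
    split_ifs with hm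
    · have h1 := (h m).2 ⟨p, rfl⟩
      have h2 : cumulative f p (m p) = f p (m p) := by
        have : Finset.Iic (m p) = {m p} := by
          ext j
          simp only [Finset.mem_Iic, Finset.mem_singleton, Fin.le_def, Fin.ext_iff]
          omega
        rw [cumulative, this, Finset.sum_singleton]
      dsimp only at h1
      linarith
    · obtain ⟨q, hq⟩ := (h (Function.update m p
        ⟨(m p).val - 1, (Nat.sub_le _ _).trans_lt (m p).isLt⟩)).1
      rw [← hq]
      have h1 := (h m).2 ⟨q, rfl⟩
      dsimp only at h1 ⊢
      by_cases hqp : q = p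
      · subst hqp
        rw [Function.update_self]
        rw [cumulative_eq_add q _ hm] at h1
        linarith
      · rw [Function.update_of_ne hqp]
        linarith [(hf p).1 (m p)]
  have := key (Function.update (lastIdx hn) p i)
  rw [← marginal_mixedDelta, mixedDelta_boxSum, Function.update_self] at this
  exact this

lemma valueTensor_top_eq (hd : 1 ≤ d) (hn : ∀ p, 0 < n p) (hf : ∀ p, IsNonincreasing (f p))
    {T : Tensor n} (h0 : ∀ x, 0 ≤ T x)
    (h : ∀ m, IsLeast (Set.range fun p => cumulative f p (m p)) (boxSum T m)) :
    boxSum T = valueTensor f ∞ := by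
  ext m
  refine le_antisymm
    (boxSum_le_valueTensor hd hf (mem_consistentNonneg_of_isLeast hn hf h0 h) m) ?_
  obtain ⟨p, hp⟩ := (h m).1
  rw [← hp]
  exact valueTensor_le_cumulative hd hf m p

/-- The run of the machine: it halts in time, with an output whose box sums are the minimal
cumulative degrees. -/
lemma exists_run (hd : 1 ≤ d) (hn : ∀ p, 0 < n p) (hf : ∀ p, IsNonincreasing (f p))
    (τ : State d → Bool) :
    ∃ N ≤ 14 * d * ∑ p, n p, ((step n τ)^[N] (start f)).loc = Loc.halt ∧
      ((step n τ)^[N] (start f)).len ≤ ∑ p, n p ∧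
      (∀ x, 0 ≤ ((step n τ)^[N] (start f)).output n x) ∧
      ∀ m, IsLeast (Set.range fun p => cumulative f p (m p))
        (boxSum (((step n τ)^[N] (start f)).output n) m) := by
  obtain ⟨N, hN, t, h1, h2, p, hp⟩ := exists_halt (τ := τ) hd hf (∑ p, n p)
    { start f with loc := Loc.test 0 } 0 rfl ((invariant_start hf).of_eq rfl) (by omega)
  rw [← iterate_init_done (n := n) (τ := τ) (start f) rfl rfl,
    ← Function.iterate_add_apply] at h1 h2 hp
  refine ⟨N + (d + 1), ?_, h1, ?_, output_nonneg h2, isLeast_boxSum_output hf h2 hp⟩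
  · have hs : 1 ≤ ∑ p, n p := (hn ⟨0, hd⟩).trans_le
      (Finset.single_le_sum (f := n) (fun _ _ => Nat.zero_le _) (Finset.mem_univ _))
    -- a pass takes `4 d + 6 ≤ 10 d` steps; initialization and last test take `2 (d + 1) ≤ 4 d`
    nlinarith [Nat.mul_le_mul hd hs, Nat.mul_le_mul_left d hs,
      Nat.mul_le_mul_right (∑ p, n p) hd]
  · rw [h2.len_eq]
    exact Finset.sum_le_sum fun p _ => h2.pos_le p

end

end StarQuery

end

open StarQuery
theorem theorem3p1 :
    -- the universal claims, for arbitrary degree sequences and arbitrary `B ∈ [0, ∞]`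
    (∀ (d : ℕ) (_ : 1 ≤ d) (n : Fin d → ℕ) (_ : ∀ p, 0 < n p)
      (f : Vectors n) (_ : ∀ p, IsNonincreasing (f p)) (B : ℝ≥0∞),
      -- the maximum that defines `V` is attained
      (∀ m : Idx n, IsGreatest (boxSums f B m) (valueTensor f B m)) ∧
      -- (1) `C` is a solution of the worst-case tensor problem, and it is tight
      IsWorstCaseSolution f B (worstCaseTensor f B) ∧
      (∀ m : Idx n, (∀ p, IsNonincreasing (oneZero m p)) ∧
        ∃ M ∈ consistentNonneg f B,
          dot M (oneZero m) = dot (worstCaseTensor f B) (oneZero m)) ∧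
      -- (2) uniqueness
      (∀ C' ∈ consistentNonneg f B, IsWorstCaseSolution f B C' → C' = worstCaseTensor f B) ∧
      -- (3) two dimensions: non-negativity and integrality
      (d = 2 →
        (∀ x, 0 ≤ worstCaseTensor f B x) ∧
        ((∀ p i, ∃ k : ℤ, f p i = k) → (B = ∞ ∨ ∃ k : ℕ, B = k) →
          ∀ x, ∃ k : ℤ, worstCaseTensor f B x = k)) ∧
      -- (5) products with non-increasing vectors
      (∀ (q : Fin d) (a : Vectors n), (∀ p, p ≠ q → IsNonincreasing (a p)) →
        IsNonincreasing (dotExcept q (worstCaseTensor f B) a))) ∧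
    -- (3) three or more dimensions: negative entries occur
    (∀ (d : ℕ) (_ : 3 ≤ d) (b : ℝ≥0) (_ : 0 < b),
      ∃ (n : Fin d → ℕ) (f : Vectors n), (∀ p, 0 < n p) ∧ (∀ p, IsNonincreasing (f p)) ∧
        ∃ x, worstCaseTensor f (b : ℝ≥0∞) x < 0) ∧
    -- (4) inconsistency with a finite `B` occurs, already for two dimensions
    (∀ (d : ℕ) (_ : 2 ≤ d) (b : ℝ≥0) (_ : 0 < b),
      ∃ (n : Fin d → ℕ) (f : Vectors n), (∀ p, 0 < n p) ∧ (∀ p, IsNonincreasing (f p)) ∧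
        ∃ x, (b : ℝ) < worstCaseTensor f (b : ℝ≥0∞) x) ∧
    -- (6) the case `B = ∞`
    (∀ (d : ℕ) (_ : 1 ≤ d) (n : Fin d → ℕ) (_ : ∀ p, 0 < n p)
      (f : Vectors n) (_ : ∀ p, IsNonincreasing (f p)),
      (∀ m : Idx n, IsLeast (Set.range fun p => cumulative f p (m p)) (valueTensor f ∞ m)) ∧
      worstCaseTensor f ∞ ∈ consistentNonneg f ∞) ∧
    -- (6) the greedy algorithm: at most `∑ n_p` passes through the loop (one entry is output
    -- per pass), at most `c * d * ∑ n_p` elementary steps, and the result is `C`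
    (∃ c : ℕ, ∀ (d : ℕ) (_ : 1 ≤ d) (n : Fin d → ℕ) (_ : ∀ p, 0 < n p)
      (f : Vectors n) (_ : ∀ p, IsNonincreasing (f p)) (τ : State d → Bool),
      ∃ N : ℕ, N ≤ c * d * ∑ p, n p ∧
        ((step n τ)^[N] (start f)).loc = Loc.halt ∧
        ((step n τ)^[N] (start f)).len ≤ ∑ p, n p ∧
        ((step n τ)^[N] (start f)).output n = worstCaseTensor f ∞) := by
  refine ⟨fun d hd n hn f hf B => ⟨isGreatest_valueTensor hd hf,
    isWorstCaseSolution_worstCaseTensor hd hn hf,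
    fun m => ⟨isNonincreasing_oneZero m, ?_⟩,
    fun C' hC' h => eq_worstCaseTensor_of_isWorstCaseSolution hd hf hC' h,
    fun hd2 => ?_, fun q a ha => isNonincreasing_dotExcept hd hf q a ha⟩,
    exists_worstCaseTensor_neg, exists_lt_worstCaseTensor, fun d hd n hn f hf => ?_, 14,
    fun d hd n hn f hf τ => ?_⟩
  · obtain ⟨M, hM, h⟩ := exists_boxSum_eq (B := B) hd hf m
    exact ⟨M, hM, by rw [dot_oneZero, dot_oneZero, boxSum_worstCaseTensor, h]⟩
  · subst hd2
    exact ⟨worstCaseTensor_two_nonneg hf, worstCaseTensor_two_isInt hf⟩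
  · obtain ⟨N, -, -, -, h0, h⟩ := exists_run hd hn hf fun _ => true
    have hV := valueTensor_top_eq hd hn hf h0 h
    rw [← hV, ← eq_worstCaseTensor_of_boxSum hV]
    exact ⟨h, mem_consistentNonneg_of_isLeast hn hf h0 h⟩
  · obtain ⟨N, hN, h1, h2, h0, h⟩ := exists_run hd hn hf τ
    exact ⟨N, hN, h1, h2, eq_worstCaseTensor_of_boxSum (valueTensor_top_eq hd hn hf h0 h)⟩
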